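/- **Theorem (Exploration).** *Setting.* Let $y=\theta_*^\top x+\xi$, where $\theta_*\in\mathbb R^d$ has $s_*=\|\theta_*\|_0$ nonzero entries, $x\sim D_X$ is a random vector in $\mathbb R^d$ with $\|x\|_\infty\le R_\infty$ almost surely, and $\xi$ is independent of $x$, has mean zero and is sub-Gaussian with parameter $\sigma^2$, i.e. $\mathbb E e^{u\xi}\le e^{\sigma^2u^2/2}$ for all $u\in\mathbb R$. Let $D$ be the law of $(x,y)$, $\ell_y(a)=(a-y)^2$ and $\mathcal L(\theta)=\mathbb E_{(x,y)\sim D}[\ell_y(\theta^\top x)]$. Let $1\le s<s'\le d$ be integers and let $L_s,\mu_s>0$ be such that, for all $\theta_1,\theta_2\in\mathbb R^d$ with $\|\theta_1\|_0,\|\theta_2\|_0\le s$, $$\tfrac{\mu_s}{2}\|\theta_1-\theta_2\|^2\le \mathcal L(\theta_1)-\mathcal L(\theta_2)-\langle\nabla\mathcal L(\theta_2),\theta_1-\theta_2\rangle\le\tfrac{L_s}{2}\|\theta_1-\theta_2\|^2$$ (restricted strong convexity and restricted smoothness). Put $\kappa_s=L_s/\mu_s$. *Algorithm.* Let $\mathcal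 H_s(v)$ be a Euclidean projection of $v$ onto the vectors with at most $s$ nonzero entries (ties broken by any fixed measurable rule). Given an initial point, a step size $\eta>0$, batch sizes $B_t\ge1$ and $T\in\mathbb N$, let $\theta_0$ be $\mathcal H_s$ of the initial point, let $d'=\lceil d/(s'-s)\rceil$, and let $J_i=\{(s'-s)(i-1)+1,\dots,\min((s'-s)i,d)\}$ for $1\le i\le d'$. In round $t=1,\dots,T$ draw fresh independent examples $(x_i^{(b)},y_i^{(b)})\sim D$ for $1\le i\le d'$, $1\le b\le B_t$; of $x_i^{(b)}$ only the attributes in $J_i$ and in $\mathrm{supp}(\theta_{t-1})$ are observed. Set, for each $i$ and each $j\in J_i$, $$(g_t)_j=\frac1{B_t}\sum_{b=1}^{B_t}\ell'_{y_i^{(b)}}\Big(\sum_{k\in\mathrm{supp}(\theta_{t-1})}(\theta_{t-1})_k\,(x_i^{(b)})_k\Big)(x_i^{(b)})_j ,\qquad \theta_t=\mathcal H_s(\theta_{t-1}-\eta g_t).$$ *Claim.* There are universal constants $C_s,c_\eta,c_\alpha,C_B>0$ with $c_\alpha<1$ such that the following holds with $\eta=c_\eta/L_s$ and $\check\alpha=c_\alpha/\kappa_s$,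 for every such model, every initial point, every $T\in\mathbb N$, all integers $1\le s<s'\le d$ with $s\ge C_s\kappa_s^2s_*$ (in particular those with $s$ between $C_s\kappa_s^2s_*$ and a constant multiple of it), all $\delta\in(0,1)$ and all $\Delta>0$. There is an integer $B_0\ge1$ with $$B_0\le C_B\,\log\!\Big(\frac{\kappa_s d}{\delta}\Big)\,\max\left\{\kappa_s^2\,\frac{R_\infty^4}{L_s^2}\,s^2,\ \frac{\sigma^2}{\Delta}\,\frac{R_\infty^2}{L_s}\,\frac{T s}{(1-\check\alpha)^T}\right\}$$ such that, whenever $B_t\ge B_0$ for all $1\le t\le T$ (in particular for $B_t=B_0$), $$P\Big(\mathcal L(\theta_T)-\mathcal L(\theta_*)\le(1-\check\alpha)^T\big(\mathcal L(\theta_0)-\mathcal L(\theta_*)+\Delta\big)\Big)\ge1-\delta .$$ -/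

import Mathlib

open MeasureTheory ProbabilityTheory
open scoped NNReal

noncomputable section

namespace SparseReg

/-- `ℝ^d` with the Euclidean norm. -/
abbrev Vec (d : ℕ) : Type := EuclideanSpace ℝ (Fin d)

/-- The support of a vector. -/
def supp {d : ℕ} (θ : Vec d) : Finset (Fin d) :=
  Finset.univ.filter fun j => θ j ≠ 0

/-- The number `‖θ‖₀` of nonzero entries. -/
def l0 {d : ℕ} (θ : Vec d) : ℕ := (supp θ).card

/-- The squared loss `ℓ_y(a) = (a - y)²`. -/
def sqLoss (y a : ℝ) : ℝ := (a - y) ^ 2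

/-- The joint law of `(x, y)` with `y = θ_*ᵀ x + ξ`, where `x ∼ DX` and the noise `ξ ∼ ν` is
independent of `x`. -/
def jointLaw {d : ℕ} (DX : Measure (Vec d)) (ν : Measure ℝ) (θstar : Vec d) :
    Measure (Vec d × ℝ) :=
  (DX.prod ν).map fun p => (p.1, inner ℝ θstar p.1 + p.2)

/-- The population risk `L(θ) = E_{(x,y) ∼ D} [ℓ_y(θᵀ x)]`. -/
def risk {d : ℕ} (D : Measure (Vec d × ℝ)) (θ : Vec d) : ℝ :=
  ∫ z, sqLoss z.2 (inner ℝ θ z.1) ∂D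

/-- Restricted smoothness with constant `Ls` over `s`-sparse vectors. -/
def RestrictedSmooth {d : ℕ} (f : Vec d → ℝ) (s : ℕ) (Ls : ℝ) : Prop :=
  ∀ θ₁ θ₂ : Vec d, l0 θ₁ ≤ s → l0 θ₂ ≤ s →
    f θ₁ ≤ f θ₂ + inner ℝ (gradient f θ₂) (θ₁ - θ₂) + Ls / 2 * ‖θ₁ - θ₂‖ ^ 2

/-- Restricted strong convexity with constant `μs` over `s`-sparse vectors. -/
def RestrictedStronglyConvex {d : ℕ} (f : Vec d → ℝ) (s : ℕ) (μs : ℝ) : Prop :=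
  ∀ θ₁ θ₂ : Vec d, l0 θ₁ ≤ s → l0 θ₂ ≤ s →
    f θ₂ + inner ℝ (gradient f θ₂) (θ₁ - θ₂) + μs / 2 * ‖θ₁ - θ₂‖ ^ 2 ≤ f θ₁

/-- `H` is a hard thresholding operator: `H v` is a Euclidean projection of `v` onto the
`s`-sparse vectors. The minimizer need not be unique, so `H` fixes a way of breaking ties. -/
def IsHardThreshold {d : ℕ} (s : ℕ) (H : Vec d → Vec d) : Prop :=
  ∀ v : Vec d, l0 (H v) ≤ s ∧ ∀ w : Vec d, l0 w ≤ s → ‖H v - v‖ ≤ ‖w - v‖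

/-- The block-wise mini-batch gradient estimator at `θ`. With coordinates numbered from `0`, the
attributes are cut into consecutive blocks of length `m`, so that the coordinate `j` lies in the
block `j / m`. The entry `j` is computed from the `B` examples `z (j / m) 0, …, z (j / m) (B - 1)`
that belong to its block, of which only the response, the attributes in that block and the
attributes in the support of `θ` are used. -/
def gradEst {d : ℕ} (m B : ℕ) (z : ℕ → ℕ → Vec d × ℝ) (θ : Vec d) : Vec d :=
  WithLp.toLp 2 fun j : Fin d =>
    (1 / (B : ℝ)) * ∑ b ∈ Finset.range B,
      deriv (sqLoss (z (j / m) b).2) (∑ k ∈ supp θ, θ k * (z (j / m) b).1 k) *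
        (z (j / m) b).1 j

/-- The iterates `θ_t` of the Exploration algorithm with hard thresholding operator `H`, step size
`η`, block length `m`, batch sizes `B` and initial point `θ₀`, which is thresholded first. The
example number `b` of the block `i` in the round `t` is `z t i b`. -/
def exploration {d : ℕ} (H : Vec d → Vec d) (η : ℝ) (m : ℕ) (B : ℕ → ℕ)
    (z : ℕ → ℕ → ℕ → Vec d × ℝ) (θ₀ : Vec d) : ℕ → Vec d
  | 0 => H θ₀
  | t + 1 =>
    H (exploration H η m B z θ₀ t -
      η • gradEst m (B (t + 1)) (z (t + 1)) (exploration H η m B z θ₀ t))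

end SparseReg

end

/-! The noise is centred and independent of `x`, so the excess risk of `θ` is exactly `quad DX (θ -
θstar)`; write `e_t` for its value at the `t`-th iterate. A thresholded step of length `1/(2L)`
along an inexact gradient satisfies, deterministically, `e_{t+1} ≤ (1 - 8α) e_t + ζ_t` with `α =
1/(128κ)`, where `ζ_t` is `2s/L` times the squared supremum norm of the gradient error
(`hardThreshold_step_le`). The supremum norm suffices because the error is only tested on at most
`2s` coordinates.

Given the past, each coordinate of the error averages `B` independent sub-Gaussian terms with
variance proxy of order `R⁴ ‖θ - θ_*‖₁² + R² σ²`. Sparsity and strong convexity bound `‖θ - θ_*‖₁²`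
by `4 s e_t / μ`, so the first part of the error shrinks with the suboptimality. The batch size
makes the conditional `p`-th moment of `ζ_t` at most `γ (α e_t + y)^p`, where `p = ⌈log (κd/δ)⌉`, `γ
= 2d e^{-9p}` and `y = Δ (1 - α)^T / (3T)`.

A plain union bound over the rounds would put `log T` into the batch size. It is used only if `αT <
1`, where `T ≤ 128κ` and `log κ` is already paid for (`measure_not_contraction_le_of_tail`). If `αT
≥ 1`, convexity propagates moments instead: `E[e_T^p] ≤ (1 - 7α)^{pT} e_0^p + (y/α)^p`. Over `T`
rounds the gap between the rates `1 - 7α` and `1 - α` is worth a factor `e^{-1}`, hence `e^{-p} ≤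
δ/2` in the `p`-th power, and Markov's inequality concludes
(`measure_not_contraction_le_of_moment`). -/

/-! ### Hard thresholding with an inexact gradient -/

/-- A finite set has a subset of any given size whose sum is at most the proportional share. -/
theorem Finset.exists_subset_card_sum_le_average {ι : Type*} [DecidableEq ι] (S : Finset ι)
    (f : ι → ℝ) (r : ℕ) (hr : r ≤ S.card) :
    ∃ E ⊆ S, E.card = r ∧ (S.card : ℝ) * ∑ i ∈ E, f i ≤ r * ∑ i ∈ S, f i := by
  induction hk : S.card generalizing S with
  | zero =>
    refine ⟨∅, by simp, by simp; omega, ?_⟩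
    have : S = ∅ := Finset.card_eq_zero.mp hk
    simp [this]
  | succ k ih =>
    rcases hr.eq_or_lt with h | h
    · exact ⟨S, subset_rfl, h.symm, by rw [h, hk]⟩
    · have hne : S.Nonempty := Finset.card_pos.mp (by omega)
      -- Putting the largest element back adds `r * f a` on the right, which dominates the sum over
      -- `E` added on the left.
      obtain ⟨a, ha, hmax⟩ := S.exists_max_image f hne
      have hc : (S.erase a).card = k := by rw [Finset.card_erase_of_mem ha]; omega
      obtain ⟨E, hE, hEr, hEs⟩ := ih (S.erase a) (by omega) hc
      refine ⟨E, hE.trans (Finset.erase_subset _ _), hEr, ?_⟩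
      have hsum : ∑ i ∈ S, f i = f a + ∑ i ∈ S.erase a, f i :=
        (Finset.add_sum_erase S f ha).symm
      have hle : ∑ i ∈ S.erase a, f i ≤ k * f a := by
        have := Finset.sum_le_card_nsmul (S.erase a) f (f a)
          (fun i hi => hmax i (Finset.mem_of_mem_erase hi))
        rwa [hc, nsmul_eq_mul] at this
      have hEa : ∑ i ∈ E, f i ≤ r * f a := by
        have := Finset.sum_le_card_nsmul E f (f a)
          (fun i hi => hmax i (Finset.mem_of_mem_erase (hE hi)))
        rwa [hEr, nsmul_eq_mul] at this
      rw [hsum]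
      push_cast
      linarith

namespace SparseReg

variable {d : ℕ}

theorem mem_supp {θ : Vec d} {j : Fin d} : j ∈ supp θ ↔ θ j ≠ 0 := by
  simp [supp]

theorem eq_zero_of_notMem_supp {θ : Vec d} {j : Fin d} (h : j ∉ supp θ) : θ j = 0 := by
  by_contra h'
  exact h (mem_supp.mpr h')

theorem inner_eq_sum (a b : Vec d) : inner ℝ a b = ∑ j, a j * b j := by
  rw [PiLp.inner_apply]
  exact Finset.sum_congr rfl fun j _ => by simp [mul_comm]

theorem inner_eq_sum_of_supp_subset {a b : Vec d} {J : Finset (Fin d)} (h : supp b ⊆ J) :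
    inner ℝ a b = ∑ j ∈ J, a j * b j := by
  rw [inner_eq_sum]
  symm
  refine Finset.sum_subset (Finset.subset_univ _) fun j _ hj => ?_
  rw [eq_zero_of_notMem_supp fun h' => hj (h h'), mul_zero]

theorem norm_sq_eq_sum (a : Vec d) : ‖a‖ ^ 2 = ∑ j, a j ^ 2 := by
  rw [EuclideanSpace.real_norm_sq_eq]

theorem supp_sub_subset (a b : Vec d) : supp (a - b) ⊆ supp a ∪ supp b := by
  intro j hj
  rw [Finset.mem_union, mem_supp, mem_supp]
  rw [mem_supp] at hj
  by_contra! h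
  exact hj (by simp [h.1, h.2])

theorem sum_sq_le_norm_sq (a : Vec d) (J : Finset (Fin d)) : ∑ j ∈ J, a j ^ 2 ≤ ‖a‖ ^ 2 := by
  rw [norm_sq_eq_sum]
  exact Finset.sum_le_sum_of_subset_of_nonneg (Finset.subset_univ _) fun j _ _ => sq_nonneg _

theorem inner_sq_le_of_supp_subset {a b : Vec d} {J : Finset (Fin d)} (h : supp b ⊆ J) :
    (inner ℝ a b) ^ 2 ≤ (∑ j ∈ J, a j ^ 2) * ‖b‖ ^ 2 := by
  rw [inner_eq_sum_of_supp_subset h]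
  refine (Finset.sum_mul_sq_le_sq_mul_sq J _ _).trans ?_
  exact mul_le_mul_of_nonneg_left (sum_sq_le_norm_sq b J)
    (Finset.sum_nonneg fun j _ => sq_nonneg _)

/-- A small set of coordinates outside the support of `x` can be dropped from `v` to make it
sparse. -/
theorem exists_small_truncation (θ x : Vec d) (f : Fin d → ℝ) (hf : ∀ j, 0 ≤ f j) {s : ℕ}
    (hθ : l0 θ ≤ s) (hx : l0 x ≤ s) :
    ∃ E ⊆ supp θ \ supp x, ((supp θ ∪ supp x) \ E).card ≤ s ∧
      (s : ℝ) * ∑ j ∈ E, f j ≤ l0 x * ∑ j ∈ supp θ \ supp x, f j := by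
  have hJ : (supp θ ∪ supp x).card = (supp θ \ supp x).card + l0 x := by
    rw [← Finset.sdiff_union_self_eq_union, Finset.card_union_of_disjoint Finset.sdiff_disjoint]
    rfl
  have hk : (supp θ \ supp x).card ≤ s := (Finset.card_le_card Finset.sdiff_subset).trans hθ
  -- The union of the supports exceeds size `s` by this many elements; truncated subtraction gives
  -- `0` when nothing has to be dropped.
  obtain ⟨E, hE, hEr, hEs⟩ := Finset.exists_subset_card_sum_le_average (supp θ \ supp x) f
    ((supp θ \ supp x).card + l0 x - s) (by omega)
  refine ⟨E, hE, ?_, ?_⟩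
  · have : E ⊆ supp θ ∪ supp x := hE.trans (Finset.sdiff_subset.trans Finset.subset_union_left)
    rw [Finset.card_sdiff_of_subset this, hJ, hEr]
    omega
  · set k := (supp θ \ supp x).card
    have hsum : 0 ≤ ∑ j ∈ supp θ \ supp x, f j := Finset.sum_nonneg fun j _ => hf j
    rcases le_or_gt (k + l0 x) s with h | h
    · have : E = ∅ := Finset.card_eq_zero.mp (by omega)
      subst this
      simpa using mul_nonneg (Nat.cast_nonneg (l0 x)) hsum
    · have hr : ((k + l0 x - s : ℕ) : ℝ) = k + l0 x - s := by
        rw [Nat.cast_sub h.le]; push_cast; ring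
      rw [hr] at hEs
      have hkpos : (0 : ℝ) < k := by
        have : 0 < k := by omega
        exact_mod_cast this
      have h1 : (k : ℝ) ≤ s := by exact_mod_cast hk
      have h2 : (l0 x : ℝ) ≤ s := by exact_mod_cast hx
      -- This is `(s - k) (s - l0 x) ≥ 0`.
      have h3 : (s : ℝ) * (k + l0 x - s) ≤ l0 x * k := by nlinarith
      have h4 : (k : ℝ) * (s * ∑ j ∈ E, f j) ≤ k * (l0 x * ∑ j ∈ supp θ \ supp x, f j) := by
        calc (k : ℝ) * (s * ∑ j ∈ E, f j) = s * (k * ∑ j ∈ E, f j) := by ring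
          _ ≤ s * ((k + l0 x - s) * ∑ j ∈ supp θ \ supp x, f j) := by gcongr
          _ = (s * (k + l0 x - s)) * ∑ j ∈ supp θ \ supp x, f j := by ring
          _ ≤ (l0 x * k) * ∑ j ∈ supp θ \ supp x, f j := by gcongr
          _ = _ := by ring
      exact le_of_mul_le_mul_left h4 hkpos

/-- The value of the proximal model at a hard thresholding step. -/
theorem prox_hardThreshold_le {s : ℕ} {H : Vec d → Vec d} (hH : IsHardThreshold s H)
    (θ x g : Vec d) (η : ℝ) (hs : 1 ≤ s) (hθ : l0 θ ≤ s) (hx : l0 x ≤ s) :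
    2 * η * inner ℝ g (H (θ - η • g) - θ) + ‖H (θ - η • g) - θ‖ ^ 2 ≤
      (l0 x / s : ℝ) * (2 * ‖θ - x‖ ^ 2 + 2 * (η ^ 2 * ∑ j ∈ supp θ ∪ supp x, g j ^ 2)) -
        η ^ 2 * ∑ j ∈ supp θ ∪ supp x, g j ^ 2 := by
  set v := θ - η • g with hv
  obtain ⟨E, hE, hEc, hEs⟩ :=
    exists_small_truncation θ x (fun j => v j ^ 2) (fun j => sq_nonneg _) hθ hx
  set J := supp θ ∪ supp x with hJ
  have hEJ : E ⊆ J := hE.trans (Finset.sdiff_subset.trans Finset.subset_union_left)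
  -- The competitor for the projection keeps `v` on both supports except on the cheap set `E`; it
  -- realises the full gradient decrease on `J` up to the mass of `v` on `E`.
  set w : Vec d := WithLp.toLp 2 fun j => if j ∈ J \ E then v j else 0 with hw
  have hwj : ∀ j, w j = if j ∈ J \ E then v j else 0 := fun j => rfl
  have hwl : l0 w ≤ s := by
    refine le_trans (Finset.card_le_card fun j hj => ?_) hEc
    rw [mem_supp, hwj] at hj
    by_contra h
    exact hj (if_neg h)
  have hexp : ∀ a : Vec d, ‖a - v‖ ^ 2 = ‖a - θ‖ ^ 2 + 2 * η * inner ℝ g (a - θ) +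
      ‖η • g‖ ^ 2 := by
    intro a
    have : a - v = (a - θ) + η • g := by rw [hv]; abel
    rw [this, norm_add_sq_real, inner_smul_right, real_inner_comm]
    ring
  have hmin : ‖H v - v‖ ^ 2 ≤ ‖w - v‖ ^ 2 := by
    have := (hH v).2 w hwl
    gcongr
  rw [hexp, hexp] at hmin
  have hval : 2 * η * inner ℝ g (w - θ) + ‖w - θ‖ ^ 2 =
      ∑ j ∈ E, v j ^ 2 - η ^ 2 * ∑ j ∈ J, g j ^ 2 := by
    rw [inner_eq_sum, norm_sq_eq_sum, Finset.mul_sum, Finset.mul_sum, ← Finset.sum_add_distrib,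
      ← Finset.sum_indicator_subset _ (Finset.subset_univ E),
      ← Finset.sum_indicator_subset _ (Finset.subset_univ J), ← Finset.sum_sub_distrib]
    refine Finset.sum_congr rfl fun j _ => ?_
    have hvj : v j = θ j - η * g j := by simp [hv]
    have hsub : (w - θ) j = w j - θ j := rfl
    rw [hsub, hwj]
    by_cases h1 : j ∈ J
    · by_cases h2 : j ∈ E
      · simp [h1, h2, hvj]; ring
      · simp [h1, h2, hvj]; ring
    · have h2 : j ∉ E := fun h => h1 (hEJ h)
      have h3 : θ j = 0 :=
        eq_zero_of_notMem_supp fun h => h1 (Finset.mem_union_left _ h)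
      simp [h1, h2, h3]
  have hspos : (0 : ℝ) < s := by exact_mod_cast hs
  have hK : ∑ j ∈ supp θ \ supp x, v j ^ 2 ≤
      2 * ‖θ - x‖ ^ 2 + 2 * (η ^ 2 * ∑ j ∈ J, g j ^ 2) := by
    calc ∑ j ∈ supp θ \ supp x, v j ^ 2
        ≤ ∑ j ∈ supp θ \ supp x, (2 * (θ - x) j ^ 2 + 2 * (η ^ 2 * g j ^ 2)) := by
          refine Finset.sum_le_sum fun j hj => ?_
          -- Off the support of `x`, `θ` coincides with `θ - x`; this is how the distance to `x`
          -- enters.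
          have hxj : x j = 0 := eq_zero_of_notMem_supp (Finset.mem_sdiff.mp hj).2
          have hvj : v j = θ j - η * g j := by simp [hv]
          have hsub : (θ - x) j = θ j := by simp [hxj]
          rw [hvj, hsub]
          nlinarith [sq_nonneg (θ j + η * g j)]
      _ ≤ ∑ j ∈ J, (2 * (θ - x) j ^ 2 + 2 * (η ^ 2 * g j ^ 2)) :=
          Finset.sum_le_sum_of_subset_of_nonneg
            (Finset.sdiff_subset.trans Finset.subset_union_left) fun j _ _ => by positivity
      _ = 2 * ∑ j ∈ J, (θ - x) j ^ 2 + 2 * (η ^ 2 * ∑ j ∈ J, g j ^ 2) := by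
          rw [Finset.sum_add_distrib, Finset.mul_sum, Finset.mul_sum, Finset.mul_sum]
      _ ≤ _ := by
          have := sum_sq_le_norm_sq (θ - x) J
          linarith
  have hE' : ∑ j ∈ E, v j ^ 2 ≤
      (l0 x / s : ℝ) * (2 * ‖θ - x‖ ^ 2 + 2 * (η ^ 2 * ∑ j ∈ J, g j ^ 2)) := by
    rw [div_mul_eq_mul_div, le_div_iff₀ hspos, mul_comm]
    exact hEs.trans (by gcongr)
  linarith

/-- Scalar bookkeeping for one step. The surplus `L * N` left by the step size `1/(2L)` pays half
for smoothness and half for the gradient error. The decrease `S / (8L)` is worth `e / (8κ)` up to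
the error, and the truncation loss `2ρLD ≤ 4κρe` takes at most half of that exactly when `64κ²ρ ≤
1`. -/
theorem suboptimality_le_of_prox_le {L μ κ s ρ S D N Z a b e e' : ℝ} (hL : 0 < L) (hμ : 0 < μ)
    (hκ : κ = L / μ) (hκ2 : 1 ≤ κ ^ 2) (hs : 0 ≤ s) (hρ0 : 0 ≤ ρ) (hρκ : 64 * κ ^ 2 * ρ ≤ 1)
    (he0 : 0 ≤ e) (hS0 : 0 ≤ S) (hZ0 : 0 ≤ Z) (he : μ / 2 * D ≤ e) (hS : μ * e - 2 * s * Z ≤ S)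
    (hq : a + L * N ≤ L * (2 * ρ * D) - (1 - 2 * ρ) / (4 * L) * S)
    (hcross : b ≤ L / 2 * N + s / L * Z) (he' : e' ≤ e + a + b + L / 2 * N) :
    e' ≤ (1 - 1 / (16 * κ)) * e + 2 * s / L * Z := by
  have hκ0 : 0 < κ := by rw [hκ]; positivity
  have hρ4 : ρ ≤ 1 / 4 := by
    have h1 := mul_le_mul_of_nonneg_right hκ2 hρ0
    linarith
  have hS' : 1 / (8 * L) * S ≤ (1 - 2 * ρ) / (4 * L) * S := by
    have h1 : 1 / (8 * L) = (1 / 2) / (4 * L) := by field_simp; norm_num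
    rw [h1]
    gcongr
    linarith
  have hS3 : 1 / (8 * κ) * e - s / (4 * L) * Z ≤ 1 / (8 * L) * S := by
    have h1 : 1 / (8 * κ) * e - s / (4 * L) * Z = 1 / (8 * L) * (μ * e - 2 * s * Z) := by
      rw [hκ]; field_simp; ring
    rw [h1]
    gcongr
  have hD' : L * (2 * ρ * D) ≤ 1 / (16 * κ) * e := by
    have h1 : L * D ≤ 2 * κ * e := by
      have : L * D = 2 * κ * (μ / 2 * D) := by rw [hκ]; field_simp
      rw [this]; gcongr
    calc L * (2 * ρ * D) = 2 * ρ * (L * D) := by ring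
      _ ≤ 2 * ρ * (2 * κ * e) := by gcongr
      _ = 1 / (16 * κ) * e * (64 * κ ^ 2 * ρ) := by field_simp; ring
      _ ≤ 1 / (16 * κ) * e * 1 := by gcongr
      _ = _ := mul_one _
  have hfin : 1 / (8 * κ) * e = 1 / (16 * κ) * e + 1 / (16 * κ) * e := by field_simp; ring
  have hZ3 : s / L * Z + s / (4 * L) * Z ≤ 2 * s / L * Z := by
    have h1 : 2 * s / L * Z - (s / L * Z + s / (4 * L) * Z) = 3 / 4 * (s / L * Z) := by
      field_simp; ring
    have h2 : 0 ≤ s / L * Z := by positivity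
    linarith
  linarith

/-- One step of inexact iterative hard thresholding contracts the suboptimality, up to the error
of the gradient in the supremum norm. -/
theorem hardThreshold_step_le {s : ℕ} {H : Vec d → Vec d} (hH : IsHardThreshold s H)
    {L μ : ℝ} (hL : 0 < L) (hμ : 0 < μ) (hLμ : μ ≤ L) (θ x g G : Vec d) {e e' Z : ℝ}
    (hs : 1 ≤ s) (hθ : l0 θ ≤ s) (hx : 64 * (L / μ) ^ 2 * l0 x ≤ s)
    (hG : inner ℝ G (θ - x) = 2 * e) (he : μ / 2 * ‖θ - x‖ ^ 2 ≤ e)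
    (he' : e' ≤ e + inner ℝ G (H (θ - (1 / 2 / L) • g) - θ) +
      L / 2 * ‖H (θ - (1 / 2 / L) • g) - θ‖ ^ 2)
    (hZ0 : 0 ≤ Z) (hZ : ∀ j, (g j - G j) ^ 2 ≤ Z) :
    e' ≤ (1 - 1 / (16 * (L / μ))) * e + 2 * s / L * Z := by
  set κ := L / μ with hκ
  have hκ1 : 1 ≤ κ := by rw [hκ, le_div_iff₀ hμ]; linarith
  have hκ2 : 1 ≤ κ ^ 2 := by nlinarith
  have hspos : (0 : ℝ) < s := by exact_mod_cast hs
  have hx0 : (0 : ℝ) ≤ l0 x := Nat.cast_nonneg _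
  have hxs : l0 x ≤ s := by
    have : (l0 x : ℝ) ≤ s := by nlinarith
    exact_mod_cast this
  have hprox := prox_hardThreshold_le hH θ x g (1 / 2 / L) hs hθ hxs
  set u := H (θ - (1 / 2 / L) • g) with hu
  set J := supp θ ∪ supp x with hJ
  set S := ∑ j ∈ J, g j ^ 2 with hS
  set D := ‖θ - x‖ ^ 2 with hD
  have hS0 : 0 ≤ S := Finset.sum_nonneg fun j _ => sq_nonneg _
  have hD0 : 0 ≤ D := sq_nonneg _
  have he0 : 0 ≤ e := le_trans (by positivity) he
  set ρ : ℝ := l0 x / s with hρ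
  have hρκ : 64 * κ ^ 2 * ρ ≤ 1 := by
    rw [hρ, ← mul_div_assoc, div_le_one hspos]; exact hx
  have hρ0 : 0 ≤ ρ := by positivity
  have hZ' : ∀ K : Finset (Fin d), K.card ≤ 2 * s → ∑ j ∈ K, (G - g) j ^ 2 ≤ 2 * s * Z := by
    intro K hK
    calc ∑ j ∈ K, (G - g) j ^ 2 ≤ ∑ j ∈ K, Z := Finset.sum_le_sum fun j _ => by
          have h1 : (G - g) j = -(g j - G j) := by simp
          rw [h1, neg_sq]; exact hZ j
      _ = K.card * Z := by simp
      _ ≤ 2 * s * Z := by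
          have : (K.card : ℝ) ≤ 2 * s := by exact_mod_cast hK
          gcongr
  have hul : l0 u ≤ s := (hH _).1
  -- the gradient error along the step
  have hcross : inner ℝ (G - g) (u - θ) ≤ L / 2 * ‖u - θ‖ ^ 2 + s / L * Z := by
    have h1 := inner_sq_le_of_supp_subset (a := G - g) (supp_sub_subset u θ)
    have h2 := hZ' (supp u ∪ supp θ) ((Finset.card_union_le _ _).trans (by
      change l0 u + l0 θ ≤ 2 * s; omega))
    have h3 : (inner ℝ (G - g) (u - θ)) ^ 2 ≤ 2 * s * Z * ‖u - θ‖ ^ 2 :=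
      h1.trans (by gcongr)
    refine abs_le_of_sq_le_sq' (h3.trans ?_) (by positivity) |>.2
    have h4 : 2 * s * Z * ‖u - θ‖ ^ 2 = 4 * (L / 2 * ‖u - θ‖ ^ 2) * (s / L * Z) := by
      field_simp
      ring
    rw [h4]
    nlinarith [sq_nonneg (L / 2 * ‖u - θ‖ ^ 2 - s / L * Z)]
  -- A Polyak–Łojasiewicz inequality on `J`: by Cauchy–Schwarz `(2e)²` is at most the sum times `D`,
  -- and `D ≤ 2e/μ`.
  have hGS : 2 * μ * e ≤ ∑ j ∈ J, G j ^ 2 := by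
    have h1 := inner_sq_le_of_supp_subset (a := G) (supp_sub_subset θ x)
    rw [hG, ← hJ, ← hD] at h1
    have hGJ : 0 ≤ ∑ j ∈ J, G j ^ 2 := Finset.sum_nonneg fun j _ => sq_nonneg _
    rcases he0.eq_or_lt with h0 | h0
    · rw [← h0]; simpa using hGJ
    · have h2 : (∑ j ∈ J, G j ^ 2) * (μ * D) ≤ (∑ j ∈ J, G j ^ 2) * (2 * e) :=
        mul_le_mul_of_nonneg_left (by linarith) hGJ
      have h3 : (2 * e) * (2 * μ * e) ≤ (2 * e) * ∑ j ∈ J, G j ^ 2 := by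
        nlinarith [mul_le_mul_of_nonneg_left h1 hμ.le]
      exact le_of_mul_le_mul_left h3 (by linarith)
  have hGg : ∑ j ∈ J, G j ^ 2 ≤ 2 * S + 2 * (2 * s * Z) := by
    have h1 := hZ' J ((Finset.card_union_le _ _).trans (by
      change l0 θ + l0 x ≤ 2 * s; omega))
    calc ∑ j ∈ J, G j ^ 2 ≤ ∑ j ∈ J, (2 * g j ^ 2 + 2 * (G - g) j ^ 2) := by
          refine Finset.sum_le_sum fun j _ => ?_
          have h1 : (G - g) j = G j - g j := rfl
          rw [h1]
          nlinarith [sq_nonneg (2 * g j - G j)]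
      _ = 2 * S + 2 * ∑ j ∈ J, (G - g) j ^ 2 := by
          rw [Finset.sum_add_distrib, Finset.mul_sum, Finset.mul_sum]
      _ ≤ _ := by linarith
  have hsplit : inner ℝ G (u - θ) = inner ℝ g (u - θ) + inner ℝ (G - g) (u - θ) := by
    rw [← inner_add_left]; congr 1; abel
  have hq : inner ℝ g (u - θ) + L * ‖u - θ‖ ^ 2 ≤
      L * (2 * ρ * D) - (1 - 2 * ρ) / (4 * L) * S := by
    have h1 := mul_le_mul_of_nonneg_left hprox hL.le
    have h2 : L * (2 * (1 / 2 / L) * inner ℝ g (u - θ) + ‖u - θ‖ ^ 2) =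
        inner ℝ g (u - θ) + L * ‖u - θ‖ ^ 2 := by field_simp
    have h3 : L * (ρ * (2 * D + 2 * ((1 / 2 / L) ^ 2 * S)) - (1 / 2 / L) ^ 2 * S) =
        L * (2 * ρ * D) - (1 - 2 * ρ) / (4 * L) * S := by field_simp; ring
    linarith
  have hS2 : μ * e - 2 * s * Z ≤ S := by linarith only [hGS, hGg]
  rw [hsplit, ← add_assoc] at he'
  exact suboptimality_le_of_prox_le hL hμ hκ hκ2 hspos.le hρ0 hρκ he0 hS0 hZ0 he hS2 hq hcross he'

end SparseReg

/-! ### The population risk as a quadratic form -/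

namespace SparseReg

variable {d : ℕ}

/-- The second moment of the linear form given by `v`. -/
noncomputable def quad (DX : Measure (Vec d)) (v : Vec d) : ℝ := ∫ x, (inner ℝ v x) ^ 2 ∂DX

/-- The gradient of `quad`. -/
noncomputable def gradQuad (DX : Measure (Vec d)) (v : Vec d) : Vec d :=
  WithLp.toLp 2 fun j => ∫ x, 2 * inner ℝ v x * x j ∂DX

theorem gradQuad_apply (DX : Measure (Vec d)) (v : Vec d) (j : Fin d) :
    gradQuad DX v j = ∫ x, 2 * inner ℝ v x * x j ∂DX := rfl

theorem quad_nonneg (DX : Measure (Vec d)) (v : Vec d) : 0 ≤ quad DX v :=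
  integral_nonneg fun _ => sq_nonneg _

theorem abs_inner_le {v x : Vec d} {R : ℝ} (h : ∀ j, |x j| ≤ R) :
    |inner ℝ v x| ≤ (∑ j, |v j|) * R := by
  rw [inner_eq_sum, Finset.sum_mul]
  refine (Finset.abs_sum_le_sum_abs _ _).trans (Finset.sum_le_sum fun j _ => ?_)
  rw [abs_mul]
  exact mul_le_mul_of_nonneg_left (h j) (abs_nonneg _)

variable {DX : Measure (Vec d)} [IsProbabilityMeasure DX] {R : ℝ}

theorem memLp_inner (hR : ∀ᵐ x ∂DX, ∀ j, |x j| ≤ R) (v : Vec d) (p : ENNReal) :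
    MemLp (fun x => inner ℝ v x) p DX := by
  refine MemLp.of_bound (by fun_prop) ((∑ j, |v j|) * R) ?_
  filter_upwards [hR] with x hx using abs_inner_le hx

theorem memLp_apply (hR : ∀ᵐ x ∂DX, ∀ j, |x j| ≤ R) (j : Fin d) (p : ENNReal) :
    MemLp (fun x : Vec d => x j) p DX := by
  refine MemLp.of_bound (by fun_prop) R ?_
  filter_upwards [hR] with x hx using hx j

theorem integrable_inner_sq (hR : ∀ᵐ x ∂DX, ∀ j, |x j| ≤ R) (v : Vec d) :
    Integrable (fun x => (inner ℝ v x) ^ 2) DX :=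
  (memLp_inner hR v 2).integrable_sq

theorem integrable_inner_mul_apply (hR : ∀ᵐ x ∂DX, ∀ j, |x j| ≤ R) (v : Vec d) (j : Fin d) :
    Integrable (fun x => 2 * inner ℝ v x * x j) DX := by
  have := ((memLp_inner hR v 2).integrable_mul (memLp_apply hR j 2)).const_mul 2
  simpa [mul_assoc] using this

theorem inner_gradQuad (hR : ∀ᵐ x ∂DX, ∀ j, |x j| ≤ R) (v w : Vec d) :
    inner ℝ (gradQuad DX v) w = ∫ x, 2 * inner ℝ v x * inner ℝ w x ∂DX := by
  rw [inner_eq_sum]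
  simp only [gradQuad_apply, ← integral_mul_const]
  rw [← integral_finsetSum _ fun j _ => (integrable_inner_mul_apply hR v j).mul_const _]
  refine integral_congr_ae (.of_forall fun x => ?_)
  simp only [inner_eq_sum w x, Finset.mul_sum]
  exact Finset.sum_congr rfl fun j _ => by ring

/-- The second-order expansion is exact. It therefore yields the gradient, and turns both restricted
conditions into bounds on `quad` of differences. -/
theorem quad_add (hR : ∀ᵐ x ∂DX, ∀ j, |x j| ≤ R) (v w : Vec d) :
    quad DX (v + w) = quad DX v + inner ℝ (gradQuad DX v) w + quad DX w := by
  have h1 : Integrable (fun x => 2 * inner ℝ v x * inner ℝ w x) DX := by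
    have := ((memLp_inner hR v 2).integrable_mul (memLp_inner hR w 2)).const_mul 2
    simpa [mul_assoc] using this
  have h2 : Integrable (fun x => (inner ℝ v x) ^ 2 + 2 * inner ℝ v x * inner ℝ w x) DX :=
    (integrable_inner_sq hR v).add h1
  rw [inner_gradQuad hR, quad, quad, quad, ← integral_add (integrable_inner_sq hR v) h1,
    ← integral_add h2 (integrable_inner_sq hR w)]
  refine integral_congr_ae (.of_forall fun x => ?_)
  simp only [inner_add_left]
  ring

theorem inner_gradQuad_self (hR : ∀ᵐ x ∂DX, ∀ j, |x j| ≤ R) (v : Vec d) :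
    inner ℝ (gradQuad DX v) v = 2 * quad DX v := by
  rw [inner_gradQuad hR, quad, ← integral_const_mul]
  exact integral_congr_ae (.of_forall fun x => by ring)

theorem quad_le (hR : ∀ᵐ x ∂DX, ∀ j, |x j| ≤ R) (v : Vec d) :
    quad DX v ≤ ((∑ j, |v j|) * R) ^ 2 := by
  have := integral_mono_ae (integrable_inner_sq hR v)
    (integrable_const (((∑ j, |v j|) * R) ^ 2)) (by
      filter_upwards [hR] with x hx
      rw [← sq_abs]
      gcongr
      exact abs_inner_le hx)
  simpa [quad] using this

theorem sum_abs_sq_le_of_supp_subset {v : Vec d} {J : Finset (Fin d)} (h : supp v ⊆ J) :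
    (∑ j, |v j|) ^ 2 ≤ J.card * ‖v‖ ^ 2 := by
  have h1 : ∑ j, |v j| = ∑ j ∈ J, |v j| := by
    symm
    refine Finset.sum_subset (Finset.subset_univ _) fun j _ hj => ?_
    rw [eq_zero_of_notMem_supp fun h' => hj (h h'), abs_zero]
  rw [h1]
  refine sq_sum_le_card_mul_sum_sq.trans ?_
  simp only [sq_abs]
  exact mul_le_mul_of_nonneg_left (sum_sq_le_norm_sq v J) (Nat.cast_nonneg _)

variable {ν : Measure ℝ} [IsProbabilityMeasure ν] {θstar : Vec d} {c : ℝ≥0}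

/-- The cross term factorises over the product measure and vanishes with the mean of the noise; the
noise variance cancels in every excess risk. -/
theorem risk_jointLaw (hR : ∀ᵐ x ∂DX, ∀ j, |x j| ≤ R) (hν : ∫ ξ, ξ ∂ν = 0)
    (hc : HasSubgaussianMGF (fun ξ : ℝ => ξ) c ν) (θ : Vec d) :
    risk (jointLaw DX ν θstar) θ = quad DX (θ - θstar) + ∫ ξ, ξ ^ 2 ∂ν := by
  have hi : Integrable (fun ξ : ℝ => ξ) ν := hc.integrable
  have hi2 : Integrable (fun ξ : ℝ => ξ ^ 2) ν := by
    have := (hc.memLp 2)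
    exact MemLp.integrable_sq (by simpa using this)
  have hv := (memLp_inner hR (θ - θstar) 1).integrable le_rfl
  rw [risk, jointLaw, integral_map]
  rotate_left
  · fun_prop
  · simp only [sqLoss]; fun_prop
  have h1 := ((integrable_inner_sq hR (θ - θstar)).comp_fst ν)
  have h2 := (hv.mul_prod hi).const_mul (-2)
  have h3 := hi2.comp_snd DX
  have hexp : ∀ p : Vec d × ℝ, sqLoss (inner ℝ θstar p.1 + p.2) (inner ℝ θ p.1) =
      (inner ℝ (θ - θstar) p.1) ^ 2 + -2 * (inner ℝ (θ - θstar) p.1 * p.2) + p.2 ^ 2 := by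
    intro p
    simp only [sqLoss, inner_sub_left]
    ring
  simp only [hexp]
  have h4 : Integrable (fun p : Vec d × ℝ => (inner ℝ (θ - θstar) p.1) ^ 2 +
      -2 * (inner ℝ (θ - θstar) p.1 * p.2)) (DX.prod ν) := h1.add h2
  rw [integral_add h4 h3, integral_add h1 h2, integral_const_mul,
    integral_prod_mul (fun x => inner ℝ (θ - θstar) x) (fun ξ : ℝ => ξ), hν,
    integral_fun_fst (fun x => (inner ℝ (θ - θstar) x) ^ 2),
    integral_fun_snd (fun ξ : ℝ => ξ ^ 2)]
  simp [quad]

theorem hasGradientAt_quad (hR : ∀ᵐ x ∂DX, ∀ j, |x j| ≤ R) (v : Vec d) :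
    HasGradientAt (quad DX) (gradQuad DX v) v := by
  rw [hasGradientAt_iff_isLittleO_nhds_zero]
  have h1 : (fun h : Vec d => quad DX (v + h) - quad DX v - inner ℝ (gradQuad DX v) h) =
      quad DX := by
    ext h
    rw [quad_add hR]
    ring
  rw [h1]
  have h2 : quad DX =O[nhds 0] fun h : Vec d => ‖h‖ ^ 2 := by
    refine Asymptotics.IsBigO.of_bound (d * R ^ 2) (.of_forall fun h => ?_)
    rw [Real.norm_of_nonneg (quad_nonneg _ _), Real.norm_of_nonneg (sq_nonneg _)]
    have := sum_abs_sq_le_of_supp_subset (v := h) (Finset.subset_univ _)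
    rw [Finset.card_univ, Fintype.card_fin] at this
    calc quad DX h ≤ ((∑ j, |h j|) * R) ^ 2 := quad_le hR h
      _ = (∑ j, |h j|) ^ 2 * R ^ 2 := by ring
      _ ≤ (d * ‖h‖ ^ 2) * R ^ 2 := by gcongr
      _ = _ := by ring
  exact h2.trans_isLittleO (Asymptotics.isLittleO_norm_pow_id one_lt_two)

theorem gradient_risk (hR : ∀ᵐ x ∂DX, ∀ j, |x j| ≤ R) (hν : ∫ ξ, ξ ∂ν = 0)
    (hc : HasSubgaussianMGF (fun ξ : ℝ => ξ) c ν) (θ : Vec d) :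
    gradient (risk (jointLaw DX ν θstar)) θ = gradQuad DX (θ - θstar) := by
  have h1 : risk (jointLaw DX ν θstar) = fun θ => quad DX (θ - θstar) + ∫ ξ, ξ ^ 2 ∂ν :=
    funext fun θ => risk_jointLaw hR hν hc θ
  have h2 : HasGradientAt (risk (jointLaw DX ν θstar)) (gradQuad DX (θ - θstar)) θ := by
    rw [h1, hasGradientAt_iff_hasFDerivAt]
    have := (hasGradientAt_quad hR (θ - θstar)).hasFDerivAt
    have h3 : HasFDerivAt (fun θ : Vec d => θ - θstar) (ContinuousLinearMap.id ℝ (Vec d)) θ :=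
      (hasFDerivAt_id θ).sub_const θstar
    simpa using (this.comp θ h3).add_const (∫ ξ, ξ ^ 2 ∂ν)
  exact h2.gradient

theorem continuous_quad (hR : ∀ᵐ x ∂DX, ∀ j, |x j| ≤ R) : Continuous (quad DX) :=
  continuous_iff_continuousAt.mpr fun v => (hasGradientAt_quad hR v).continuousAt

/-- By polarization each coordinate is a combination of values of `quad`. Continuity serves to make
the gradient error jointly measurable. -/
theorem continuous_gradQuad (hR : ∀ᵐ x ∂DX, ∀ j, |x j| ≤ R) : Continuous (gradQuad DX) := by
  refine (PiLp.continuous_toLp 2 _).comp (continuous_pi fun j => ?_)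
  have h1 : ∀ v, ∫ x, 2 * inner ℝ v x * x j ∂DX = quad DX (v + EuclideanSpace.single j 1) -
      quad DX v - quad DX (EuclideanSpace.single j 1) := by
    intro v
    rw [quad_add hR, ← gradQuad_apply, EuclideanSpace.inner_single_right]
    simp only [one_mul, conj_trivial]
    ring
  simp only [h1]
  have := continuous_quad hR
  fun_prop

theorem quad_le_of_restrictedSmooth (hR : ∀ᵐ x ∂DX, ∀ j, |x j| ≤ R) (hν : ∫ ξ, ξ ∂ν = 0)
    (hc : HasSubgaussianMGF (fun ξ : ℝ => ξ) c ν) {s : ℕ} {L : ℝ}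
    (h : RestrictedSmooth (risk (jointLaw DX ν θstar)) s L) {θ₁ θ₂ : Vec d} (h₁ : l0 θ₁ ≤ s)
    (h₂ : l0 θ₂ ≤ s) : quad DX (θ₁ - θ₂) ≤ L / 2 * ‖θ₁ - θ₂‖ ^ 2 := by
  have h3 := h θ₁ θ₂ h₁ h₂
  rw [gradient_risk hR hν hc, risk_jointLaw hR hν hc, risk_jointLaw hR hν hc] at h3
  have h4 : θ₁ - θstar = (θ₂ - θstar) + (θ₁ - θ₂) := by abel
  rw [h4, quad_add hR] at h3
  linarith

theorem le_quad_of_restrictedStronglyConvex (hR : ∀ᵐ x ∂DX, ∀ j, |x j| ≤ R)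
    (hν : ∫ ξ, ξ ∂ν = 0) (hc : HasSubgaussianMGF (fun ξ : ℝ => ξ) c ν) {s : ℕ} {μ : ℝ}
    (h : RestrictedStronglyConvex (risk (jointLaw DX ν θstar)) s μ) {θ₁ θ₂ : Vec d}
    (h₁ : l0 θ₁ ≤ s) (h₂ : l0 θ₂ ≤ s) : μ / 2 * ‖θ₁ - θ₂‖ ^ 2 ≤ quad DX (θ₁ - θ₂) := by
  have h3 := h θ₁ θ₂ h₁ h₂
  rw [gradient_risk hR hν hc, risk_jointLaw hR hν hc, risk_jointLaw hR hν hc] at h3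
  have h4 : θ₁ - θstar = (θ₂ - θstar) + (θ₁ - θ₂) := by abel
  rw [h4, quad_add hR] at h3
  linarith

theorem l0_single_le (j : Fin d) : l0 (EuclideanSpace.single j (1 : ℝ)) ≤ 1 := by
  rw [← Finset.card_singleton j]
  refine Finset.card_le_card fun i hi => ?_
  rw [mem_supp] at hi
  by_contra h
  rw [Finset.mem_singleton] at h
  exact hi (by simp [h])

theorem l0_zero : l0 (0 : Vec d) = 0 := by
  simp [l0, supp]

/-- The condition number is at least one and `2R²` dominates the strong convexity constant. -/
theorem le_and_le_of_quad_bounds (hR : ∀ᵐ x ∂DX, ∀ j, |x j| ≤ R) {s : ℕ} {L μ : ℝ} (hd : 0 < d)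
    (hs : 1 ≤ s)
    (hL : ∀ θ₁ θ₂ : Vec d, l0 θ₁ ≤ s → l0 θ₂ ≤ s → quad DX (θ₁ - θ₂) ≤ L / 2 * ‖θ₁ - θ₂‖ ^ 2)
    (hμ : ∀ θ₁ θ₂ : Vec d, l0 θ₁ ≤ s → l0 θ₂ ≤ s → μ / 2 * ‖θ₁ - θ₂‖ ^ 2 ≤ quad DX (θ₁ - θ₂)) :
    μ ≤ L ∧ μ ≤ 2 * R ^ 2 := by
  -- On a coordinate vector, `quad` lies between `μ/2` and `L/2`, and is at most `R²`.
  have h1 : l0 (EuclideanSpace.single (⟨0, hd⟩ : Fin d) (1 : ℝ)) ≤ s := (l0_single_le _).trans hs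
  have h2 : l0 (0 : Vec d) ≤ s := by rw [l0_zero]; omega
  have h3 := hL _ _ h1 h2
  have h4 := hμ _ _ h1 h2
  have h5 := quad_le hR (EuclideanSpace.single (⟨0, hd⟩ : Fin d) (1 : ℝ))
  have h6 : ∑ j, |(EuclideanSpace.single (⟨0, hd⟩ : Fin d) (1 : ℝ)) j| = 1 := by
    rw [Finset.sum_eq_single ⟨0, hd⟩] <;> simp +contextual
  rw [h6, one_mul] at h5
  simp only [sub_zero, PiLp.norm_single, norm_one] at h3 h4
  constructor <;> linarith

end SparseReg

/-! ### Sub-Gaussian moments and the error of the gradient estimator -/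

/-- Even moments of a sub-Gaussian random variable. -/
theorem ProbabilityTheory.HasSubgaussianMGF.lintegral_pow_le {Ω : Type*} [MeasurableSpace Ω]
    {P : Measure Ω} [IsProbabilityMeasure P] {X : Ω → ℝ} {c : ℝ≥0} (h : HasSubgaussianMGF X c P)
    {p : ℕ} (hp : 1 ≤ p) :
    ∫⁻ ω, ENNReal.ofReal (X ω ^ (2 * p)) ∂P ≤ ENNReal.ofReal (2 * (6 * p * c) ^ p) := by
  rcases eq_or_ne c 0 with rfl | hc
  · have h0 := h.ae_eq_zero_of_hasSubgaussianMGF_zero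
    have : ∫⁻ ω, ENNReal.ofReal (X ω ^ (2 * p)) ∂P = ∫⁻ ω, 0 ∂P := by
      refine lintegral_congr_ae ?_
      filter_upwards [h0] with ω hω
      rw [hω, Pi.zero_apply, zero_pow (by omega), ENNReal.ofReal_zero]
    rw [this]
    simp
  have hc0 : (0 : ℝ) < c := by exact_mod_cast pos_iff_ne_zero.mpr hc
  have hp0 : (0 : ℝ) < p := by exact_mod_cast hp
  -- This choice makes each of the two exponential moments at most `e^p`. It needs `c ≠ 0`.
  set l : ℝ := √(2 * p / c) with hl
  have hl0 : 0 < l := Real.sqrt_pos.mpr (by positivity)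
  have hl2 : l ^ 2 = 2 * p / c := Real.sq_sqrt (by positivity)
  set K : ℝ := (2 * p).factorial / l ^ (2 * p) with hK
  have hK0 : 0 ≤ K := by positivity
  have hKle : K ≤ (2 * p * c) ^ p := by
    rw [hK, pow_mul, hl2, div_le_iff₀ (by positivity), ← mul_pow]
    have h1 : (2 * p * c * (2 * p / c) : ℝ) = (2 * p) ^ 2 := by field_simp
    rw [h1, ← pow_mul]
    exact_mod_cast Nat.factorial_le_pow (2 * p)
  have hint1 := h.integrable_exp_mul l
  have hint2 := h.integrable_exp_mul (-l)
  have hpt : ∀ ω, X ω ^ (2 * p) ≤ K * (Real.exp (l * X ω) + Real.exp (-l * X ω)) := by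
    intro ω
    have h1 := Real.pow_div_factorial_le_exp (|l * X ω|) (abs_nonneg _) (2 * p)
    have h2 : Real.exp |l * X ω| ≤ Real.exp (l * X ω) + Real.exp (-l * X ω) := by
      rw [neg_mul]
      rcases abs_cases (l * X ω) with ⟨h, _⟩ | ⟨h, _⟩ <;> rw [h] <;>
        linarith [Real.exp_pos (l * X ω), Real.exp_pos (-(l * X ω))]
    rw [(even_two_mul p).pow_abs, mul_pow, div_le_iff₀ (by positivity)] at h1
    rw [hK, div_mul_eq_mul_div, le_div_iff₀ (by positivity)]
    nlinarith [mul_le_mul_of_nonneg_left h2 (Nat.cast_nonneg (α := ℝ) (2 * p).factorial)]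
  calc ∫⁻ ω, ENNReal.ofReal (X ω ^ (2 * p)) ∂P
      ≤ ∫⁻ ω, ENNReal.ofReal (K * (Real.exp (l * X ω) + Real.exp (-l * X ω))) ∂P :=
        lintegral_mono fun ω => ENNReal.ofReal_le_ofReal (hpt ω)
    _ = ENNReal.ofReal (∫ ω, K * (Real.exp (l * X ω) + Real.exp (-l * X ω)) ∂P) :=
        (ofReal_integral_eq_lintegral_ofReal ((hint1.add hint2).const_mul K)
          (.of_forall fun ω => mul_nonneg hK0
            (add_pos (Real.exp_pos _) (Real.exp_pos _)).le)).symm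
    _ ≤ _ := by
        refine ENNReal.ofReal_le_ofReal ?_
        rw [integral_const_mul, integral_add hint1 hint2]
        have h1 := h.mgf_le l
        have h2 := h.mgf_le (-l)
        have h3 : (c : ℝ) * l ^ 2 / 2 = p := by rw [hl2]; field_simp
        rw [neg_sq] at h2
        rw [h3, mgf] at h1 h2
        have h4 : Real.exp p ≤ 3 ^ p := by
          have := Real.exp_one_lt_d9
          rw [← mul_one (p : ℝ), Real.exp_nat_mul]
          gcongr
          linarith
        calc K * (∫ ω, Real.exp (l * X ω) ∂P + ∫ ω, Real.exp (-l * X ω) ∂P)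
            ≤ (2 * p * c) ^ p * (3 ^ p + 3 ^ p) := by gcongr <;> linarith
          _ = 2 * (6 * p * c) ^ p := by
            rw [← two_mul, mul_left_comm, ← mul_pow]; ring_nf

/-- A sub-Gaussian variable plus an independent sub-Gaussian noise with a bounded factor. -/
theorem ProbabilityTheory.HasSubgaussianMGF.add_mul_prod {α : Type*} [MeasurableSpace α]
    {μ : Measure α} [IsProbabilityMeasure μ] {ν : Measure ℝ} [IsProbabilityMeasure ν]
    {U V : α → ℝ} {c cU r : ℝ≥0} (hU : HasSubgaussianMGF U cU μ) (hUm : Measurable U)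
    (hVm : Measurable V) (hV : ∀ᵐ x ∂μ, |V x| ≤ r)
    (hν : HasSubgaussianMGF (fun ξ : ℝ => ξ) c ν) :
    HasSubgaussianMGF (fun p : α × ℝ => U p.1 + V p.1 * p.2) (cU + r ^ 2 * c) (μ.prod ν) := by
  have hint : ∀ t : ℝ,
      Integrable (fun p : α × ℝ => Real.exp (t * (U p.1 + V p.1 * p.2))) (μ.prod ν) := by
    intro t
    have h1 := (hU.integrable_exp_mul t).mul_prod
      ((hν.integrable_exp_mul (|t| * r)).add (hν.integrable_exp_mul (-(|t| * r))))
    refine h1.mono' (by fun_prop) ?_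
    have hV' : ∀ᵐ p ∂(μ.prod ν), |V p.1| ≤ r := Measure.quasiMeasurePreserving_fst.ae hV
    filter_upwards [hV'] with p hp
    rw [Real.norm_of_nonneg (Real.exp_pos _).le, mul_add, Real.exp_add]
    refine mul_le_mul_of_nonneg_left ?_ (Real.exp_pos _).le
    have h2 : t * (V p.1 * p.2) ≤ |(|t| * r * p.2)| := by
      refine (le_abs_self _).trans ?_
      rw [abs_mul, abs_mul, abs_mul, abs_mul, abs_abs, NNReal.abs_eq, mul_assoc]
      gcongr
    refine (Real.exp_le_exp.mpr h2).trans ?_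
    simp only [Pi.add_apply, neg_mul]
    rcases abs_cases (|t| * r * p.2) with ⟨h, _⟩ | ⟨h, _⟩ <;> rw [h] <;>
      linarith [Real.exp_pos (|t| * r * p.2), Real.exp_pos (-(|t| * r * p.2))]
  refine ⟨hint, fun t => ?_⟩
  rw [mgf, integral_prod _ (hint t)]
  -- `U` and `V` depend on the same `x`, so the noise is integrated first with `x` frozen; its
  -- factor is bounded uniformly in `x`.
  have h1 : ∀ᵐ x ∂μ, ∫ ξ, Real.exp (t * (U x + V x * ξ)) ∂ν ≤
      Real.exp (t * U x) * Real.exp (r ^ 2 * c * t ^ 2 / 2) := by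
    filter_upwards [hV] with x hx
    have h2 : ∀ ξ, Real.exp (t * (U x + V x * ξ)) =
        Real.exp (t * U x) * Real.exp (t * V x * ξ) := by
      intro ξ
      rw [← Real.exp_add]; ring_nf
    simp only [h2]
    rw [integral_const_mul]
    refine mul_le_mul_of_nonneg_left ((hν.mgf_le (t * V x)).trans ?_) (Real.exp_pos _).le
    refine Real.exp_le_exp.mpr ?_
    have h3 : V x ^ 2 ≤ (r : ℝ) ^ 2 := sq_le_sq' (abs_le.mp hx).1 (abs_le.mp hx).2
    calc (c : ℝ) * (t * V x) ^ 2 / 2 = c * t ^ 2 / 2 * V x ^ 2 := by ring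
      _ ≤ c * t ^ 2 / 2 * r ^ 2 := by gcongr
      _ = _ := by ring
  refine (integral_mono_ae (hint t).integral_prod_left
    ((hU.integrable_exp_mul t).mul_const _) h1).trans ?_
  rw [integral_mul_const]
  calc (∫ x, Real.exp (t * U x) ∂μ) * Real.exp (r ^ 2 * c * t ^ 2 / 2)
      ≤ Real.exp (cU * t ^ 2 / 2) * Real.exp (r ^ 2 * c * t ^ 2 / 2) :=
        mul_le_mul_of_nonneg_right (hU.mgf_le t) (Real.exp_pos _).le
    _ = _ := by
      rw [← Real.exp_add]
      push_cast
      ring_nf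

namespace SparseReg

variable {d : ℕ}

/-- The centred contribution of one example to the coordinate `j` of the gradient. -/
noncomputable def gradNoise (DX : Measure (Vec d)) (θstar θ : Vec d) (j : Fin d)
    (z : Vec d × ℝ) : ℝ :=
  2 * (inner ℝ θ z.1 - z.2) * z.1 j - gradQuad DX (θ - θstar) j

theorem measurable_gradNoise (DX : Measure (Vec d)) (θstar θ : Vec d) (j : Fin d) :
    Measurable (gradNoise DX θstar θ j) := by
  unfold gradNoise
  fun_prop

theorem gradEst_apply (m B : ℕ) (z : ℕ → ℕ → Vec d × ℝ) (θ : Vec d) (j : Fin d) :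
    gradEst m B z θ j = 1 / (B : ℝ) * ∑ b ∈ Finset.range B,
      2 * (inner ℝ θ (z (j / m) b).1 - (z (j / m) b).2) * (z (j / m) b).1 j := by
  have hderiv : ∀ y a : ℝ, deriv (sqLoss y) a = 2 * (a - y) := by
    intro y a
    have : HasDerivAt (sqLoss y) (2 * (a - y)) a := by
      have := ((hasDerivAt_id a).sub_const y).pow 2
      have h : sqLoss y = (fun x => id x - y) ^ 2 := rfl
      rw [h]
      simpa using this
    exact this.deriv
  have hsum : ∀ x : Vec d, ∑ k ∈ supp θ, θ k * x k = inner ℝ θ x := by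
    intro x
    rw [real_inner_comm, inner_eq_sum_of_supp_subset subset_rfl]
    exact Finset.sum_congr rfl fun _ _ => mul_comm _ _
  simp only [gradEst, hderiv, hsum]

theorem gradEst_sub_gradQuad_apply (DX : Measure (Vec d)) (θstar : Vec d) (m : ℕ) {B : ℕ}
    (hB : 1 ≤ B) (z : ℕ → ℕ → Vec d × ℝ) (θ : Vec d) (j : Fin d) :
    gradEst m B z θ j - gradQuad DX (θ - θstar) j =
      1 / (B : ℝ) * ∑ b ∈ Finset.range B, gradNoise DX θstar θ j (z (j / m) b) := by
  have hB' : (B : ℝ) ≠ 0 := by positivity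
  rw [gradEst_apply]
  simp only [gradNoise, Finset.sum_sub_distrib, Finset.sum_const, Finset.card_range, nsmul_eq_mul]
  field_simp

variable {DX : Measure (Vec d)} [IsProbabilityMeasure DX] {ν : Measure ℝ} [IsProbabilityMeasure ν]
  {θstar : Vec d} {c r : ℝ≥0}

/-- Inserting the model for `y` splits the noise into a centred version of `2⟨θ - θ_*, x⟩ x_j`,
bounded and handled by Hoeffding's lemma, and `-2 x_j ξ`. The first proxy scales with `‖θ - θ_*‖₁²`,
which makes the error self-improving. -/
theorem hasSubgaussianMGF_gradNoise (hR : ∀ᵐ x ∂DX, ∀ j, |x j| ≤ (r : ℝ))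
    (hc : HasSubgaussianMGF (fun ξ : ℝ => ξ) c ν) (θ : Vec d) (j : Fin d) :
    HasSubgaussianMGF (gradNoise DX θstar θ j)
      ((2 * (∑ j, ‖(θ - θstar) j‖₊) * r ^ 2) ^ 2 + (2 * r) ^ 2 * c)
      (jointLaw DX ν θstar) := by
  set v := θ - θstar with hv
  set K : ℝ≥0 := 2 * (∑ j, ‖v j‖₊) * r ^ 2 with hK
  have hKr : (K : ℝ) = 2 * (∑ j, |v j|) * r ^ 2 := by
    rw [hK]; push_cast; simp
  have hU : HasSubgaussianMGF (fun x => 2 * inner ℝ v x * x j - gradQuad DX v j) (K ^ 2) DX := by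
    have h1 := hasSubgaussianMGF_of_mem_Icc (μ := DX) (X := fun x => 2 * inner ℝ v x * x j)
      (a := -K) (b := K) (by fun_prop) (by
        filter_upwards [hR] with x hx
        rw [Set.mem_Icc, ← abs_le, abs_mul, abs_mul, hKr]
        have := abs_inner_le (v := v) hx
        calc |(2 : ℝ)| * |inner ℝ v x| * |x j| ≤ 2 * ((∑ j, |v j|) * r) * r := by
              rw [abs_two]
              have := hx j
              gcongr
          _ = _ := by ring)
    have h2 : (‖(K : ℝ) - -(K : ℝ)‖₊ / 2) ^ 2 = K ^ 2 := by
      have : (K : ℝ) - -(K : ℝ) = ((2 * K : ℝ≥0) : ℝ) := by push_cast; ring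
      rw [this, NNReal.nnnorm_eq, mul_div_cancel_left₀ _ two_ne_zero]
    rw [h2] at h1
    exact h1
  have h := hU.add_mul_prod (V := fun x => -2 * x j) (r := 2 * r) (by fun_prop) (by fun_prop) (by
    filter_upwards [hR] with x hx
    rw [abs_mul, abs_neg, abs_two]
    push_cast
    exact mul_le_mul_of_nonneg_left (hx j) zero_le_two) hc
  have hm : Measurable fun p : Vec d × ℝ => (p.1, inner ℝ θstar p.1 + p.2) := by fun_prop
  have hgn := measurable_gradNoise DX θstar θ j
  have hcomp : gradNoise DX θstar θ j ∘ (fun p : Vec d × ℝ => (p.1, inner ℝ θstar p.1 + p.2)) =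
      fun p => 2 * inner ℝ v p.1 * p.1 j - gradQuad DX v j + -2 * p.1 j * p.2 := by
    ext p
    simp only [Function.comp, gradNoise, hv, inner_sub_left]
    ring
  rw [← hcomp] at h
  refine ⟨fun t => ?_, fun t => ?_⟩
  · rw [jointLaw, integrable_map_measure (by fun_prop) hm.aemeasurable]
    exact h.integrable_exp_mul t
  · rw [jointLaw, mgf_map hm.aemeasurable (by fun_prop)]
    exact h.mgf_le t

/-- The union bound over coordinates at the level of moments: it costs a factor `d`, harmless once
`p` is of order `log d`. -/
theorem norm_pow_le_sum_pow (a : Fin d → ℝ) {p : ℕ} (hp : 1 ≤ p) :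
    ‖a‖ ^ (2 * p) ≤ ∑ j, a j ^ (2 * p) := by
  rcases isEmpty_or_nonempty (Fin d) with h | h
  · rw [Subsingleton.elim a 0, norm_zero, zero_pow (by omega)]
    simp
  · obtain ⟨j, hj⟩ := Finite.exists_max fun j => ‖a j‖
    have h1 : ‖a‖ ≤ ‖a j‖ := (pi_norm_le_iff_of_nonneg (norm_nonneg _)).mpr hj
    calc ‖a‖ ^ (2 * p) ≤ ‖a j‖ ^ (2 * p) := by gcongr
      _ = a j ^ (2 * p) := by rw [Real.norm_eq_abs, (even_two_mul p).pow_abs]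
      _ ≤ _ := Finset.single_le_sum (f := fun j => a j ^ (2 * p))
        (fun j _ => (even_two_mul p).pow_nonneg _) (Finset.mem_univ j)

/-- Moments of the supremum norm of the gradient error at a fixed point. -/
theorem lintegral_gradEst_error_le {Ω : Type*} [MeasurableSpace Ω] {P : Measure Ω}
    [IsProbabilityMeasure P] {Z : ℕ × ℕ × ℕ → Ω → Vec d × ℝ} (hZm : ∀ k, Measurable (Z k))
    (hZ : iIndepFun Z P)
    (hlaw : ∀ k, HasLaw (Z k) (jointLaw DX ν θstar) P) (hR : ∀ᵐ x ∂DX, ∀ j, |x j| ≤ (r : ℝ))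
    (hc : HasSubgaussianMGF (fun ξ : ℝ => ξ) c ν) (θ : Vec d) (m t : ℕ) {B p : ℕ} (hB : 1 ≤ B)
    (hp : 1 ≤ p) {A : ℝ} (hA : (∑ j, |(θ - θstar) j|) ^ 2 ≤ A) :
    ∫⁻ ω, ENNReal.ofReal (‖WithLp.ofLp (gradEst m B (fun i b => Z (t, i, b) ω) θ -
      gradQuad DX (θ - θstar))‖ ^ (2 * p)) ∂P ≤
    ENNReal.ofReal (2 * d * (6 * p * ((4 * r ^ 4 * A + 4 * r ^ 2 * c) / B)) ^ p) := by
  set C : ℝ≥0 := (2 * (∑ j, ‖(θ - θstar) j‖₊) * r ^ 2) ^ 2 + (2 * r) ^ 2 * c with hC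
  have hB0 : (0 : ℝ) < B := by exact_mod_cast hB
  have hCr : (C : ℝ) ≤ 4 * r ^ 4 * A + 4 * r ^ 2 * c := by
    rw [hC]
    push_cast
    simp only [Real.norm_eq_abs]
    calc (2 * (∑ j, |(θ - θstar) j|) * (r : ℝ) ^ 2) ^ 2 + (2 * (r : ℝ)) ^ 2 * c
        = 4 * r ^ 4 * (∑ j, |(θ - θstar) j|) ^ 2 + 4 * r ^ 2 * c := by ring
      _ ≤ _ := by gcongr
  have hcoord : ∀ j : Fin d, ∫⁻ ω, ENNReal.ofReal ((WithLp.ofLp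
      (gradEst m B (fun i b => Z (t, i, b) ω) θ - gradQuad DX (θ - θstar)) j) ^ (2 * p)) ∂P ≤
      ENNReal.ofReal (2 * (6 * p * ((4 * r ^ 4 * A + 4 * r ^ 2 * c) / B)) ^ p) := by
    intro j
    have hgn := measurable_gradNoise DX θstar θ j
    have h1 : ∀ b, HasSubgaussianMGF (fun ω => gradNoise DX θstar θ j (Z (t, j / m, b) ω)) C P := by
      intro b
      refine HasSubgaussianMGF.of_map (X := gradNoise DX θstar θ j) (hZm _).aemeasurable ?_
      rw [(hlaw _).map_eq]
      exact hasSubgaussianMGF_gradNoise hR hc θ j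
    -- One coordinate only uses the examples of its own block. Independence along `b` is all that is
    -- needed; coordinates may be dependent.
    have h2 : iIndepFun (fun b : ℕ => fun ω => gradNoise DX θstar θ j (Z (t, j / m, b) ω)) P := by
      have := (hZ.precomp (g := fun b : ℕ => (t, (j : ℕ) / m, b)) (by
        intro a b hab; simpa using hab)).comp (fun _ => gradNoise DX θstar θ j) fun _ => hgn
      exact this
    have h3 := (HasSubgaussianMGF.sum_of_iIndepFun h2 (s := Finset.range B)
      (c := fun _ => C) fun b _ => h1 b).const_mul (1 / (B : ℝ))
    have h4 := h3.lintegral_pow_le hp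
    have h5 : ∀ ω, WithLp.ofLp (gradEst m B (fun i b => Z (t, i, b) ω) θ -
        gradQuad DX (θ - θstar)) j = 1 / (B : ℝ) * ∑ b ∈ Finset.range B,
          gradNoise DX θstar θ j (Z (t, j / m, b) ω) := by
      intro ω
      rw [WithLp.ofLp_sub, Pi.sub_apply]
      exact gradEst_sub_gradQuad_apply DX θstar m hB (fun i b => Z (t, i, b) ω) θ j
    simp only [h5]
    refine h4.trans (ENNReal.ofReal_le_ofReal ?_)
    gcongr
    simp only [Finset.sum_const, Finset.card_range, nsmul_eq_mul]
    change (1 / (B : ℝ)) ^ 2 * ((B : ℝ) * (C : ℝ)) ≤ _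
    calc (1 / (B : ℝ)) ^ 2 * (B * C) = C / B := by field_simp
      _ ≤ _ := by gcongr
  calc _ ≤ ∫⁻ ω, ∑ j : Fin d, ENNReal.ofReal ((WithLp.ofLp
      (gradEst m B (fun i b => Z (t, i, b) ω) θ - gradQuad DX (θ - θstar)) j) ^ (2 * p)) ∂P := by
        refine lintegral_mono fun ω => ?_
        rw [← ENNReal.ofReal_sum_of_nonneg fun j _ => (even_two_mul p).pow_nonneg _]
        exact ENNReal.ofReal_le_ofReal (norm_pow_le_sum_pow _ hp)
    _ = ∑ j : Fin d, ∫⁻ ω, ENNReal.ofReal ((WithLp.ofLp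
      (gradEst m B (fun i b => Z (t, i, b) ω) θ - gradQuad DX (θ - θstar)) j) ^ (2 * p)) ∂P := by
        refine lintegral_finsetSum _ fun j _ => ?_
        simp only [PiLp.sub_apply, gradEst_apply]
        fun_prop
    _ ≤ ∑ j : Fin d, ENNReal.ofReal
          (2 * (6 * p * ((4 * r ^ 4 * A + 4 * r ^ 2 * c) / B)) ^ p) :=
        Finset.sum_le_sum fun j _ => hcoord j
    _ = _ := by
        rw [Finset.sum_const, Finset.card_univ, Fintype.card_fin, nsmul_eq_mul,
          ← ENNReal.ofReal_natCast, ← ENNReal.ofReal_mul (Nat.cast_nonneg _)]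
        ring_nf

end SparseReg

/-! ### Independence of the iterates from the next round -/

/-- Independent variables can be decoupled inside an integral. -/
theorem ProbabilityTheory.IndepFun.lintegral_decouple {Ω α β : Type*} [MeasurableSpace Ω]
    [MeasurableSpace α] [MeasurableSpace β] {P : Measure Ω} [IsProbabilityMeasure P] {X : Ω → α}
    {Y : Ω → β} (h : IndepFun X Y P) (hX : Measurable X) (hY : Measurable Y)
    {F : α × β → ENNReal} (hF : Measurable F) :
    ∫⁻ ω, F (X ω, Y ω) ∂P = ∫⁻ ω, ∫⁻ ω', F (X ω, Y ω') ∂P ∂P := by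
  have h1 := (indepFun_iff_map_prod_eq_prod_map_map hX.aemeasurable hY.aemeasurable).mp h
  have : IsProbabilityMeasure (P.map X) := Measure.isProbabilityMeasure_map hX.aemeasurable
  have : IsProbabilityMeasure (P.map Y) := Measure.isProbabilityMeasure_map hY.aemeasurable
  rw [← lintegral_map hF (hX.prodMk hY), h1, lintegral_prod _ hF.aemeasurable,
    lintegral_map hF.lintegral_prod_right' hX]
  refine lintegral_congr fun ω => ?_
  rw [lintegral_map (by fun_prop) hY]

namespace SparseReg

variable {d : ℕ}

theorem measurable_gradEst (m B : ℕ) :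
    Measurable fun p : Vec d × (ℕ → ℕ → Vec d × ℝ) => gradEst m B p.2 p.1 := by
  refine (PiLp.continuous_toLp 2 _).measurable.comp (g := WithLp.toLp 2)
    (f := fun p : Vec d × (ℕ → ℕ → Vec d × ℝ) => WithLp.ofLp (gradEst m B p.2 p.1)) ?_
  refine measurable_pi_iff.mpr fun j => ?_
  simp only [gradEst_apply]
  have hz : ∀ i b, Measurable fun p : Vec d × (ℕ → ℕ → Vec d × ℝ) => p.2 i b := by
    intro i b
    fun_prop
  refine (Finset.measurable_sum _ fun b _ => ?_).const_mul _
  have h1 := hz (j / m) b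
  fun_prop

theorem l0_exploration_le {s : ℕ} {H : Vec d → Vec d} (hH : IsHardThreshold s H) (η : ℝ) (m : ℕ)
    (B : ℕ → ℕ) (z : ℕ → ℕ → ℕ → Vec d × ℝ) (θ₀ : Vec d) (t : ℕ) :
    l0 (exploration H η m B z θ₀ t) ≤ s := by
  cases t <;> exact (hH _).1

section Measurability

variable {Ω : Type*} {Z : ℕ × ℕ × ℕ → Ω → Vec d × ℝ}

theorem measurable_round (S : Set (ℕ × ℕ × ℕ)) (t : ℕ) (hS : ∀ i b, (t, i, b) ∈ S) :
    Measurable[⨆ k ∈ S, MeasurableSpace.comap (Z k) inferInstance]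
      fun ω => (fun i b => Z (t, i, b) ω : ℕ → ℕ → Vec d × ℝ) := by
  refine @measurable_pi_lambda _ _ _ (_) _ _ fun i => @measurable_pi_lambda _ _ _ (_) _ _ fun b => ?_
  have h1 : MeasurableSpace.comap (Z (t, i, b)) inferInstance ≤
      ⨆ k ∈ S, MeasurableSpace.comap (Z k) inferInstance :=
    le_iSup₂_of_le (t, i, b) (hS i b) le_rfl
  exact (comap_measurable (Z (t, i, b))).mono h1 le_rfl

/-- The σ-algebra is the one generated by rounds up to `t`, not the ambient one: this is what yields
independence from round `t + 1`. -/
theorem measurable_exploration {H : Vec d → Vec d} (hH : Measurable H) (η : ℝ) (m : ℕ)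
    (B : ℕ → ℕ) (θ₀ : Vec d) (t : ℕ) :
    Measurable[⨆ k ∈ {k : ℕ × ℕ × ℕ | k.1 ≤ t}, MeasurableSpace.comap (Z k) inferInstance]
      fun ω => exploration H η m B (fun t i b => Z (t, i, b) ω) θ₀ t := by
  induction t with
  | zero => exact measurable_const
  | succ t ih =>
    have h1 := ih.mono (iSup₂_mono' fun k hk =>
      ⟨k, (show k.1 ≤ t + 1 from le_trans hk t.le_succ), le_rfl⟩ :
        (⨆ k ∈ {k : ℕ × ℕ × ℕ | k.1 ≤ t}, MeasurableSpace.comap (Z k) inferInstance) ≤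
        ⨆ k ∈ {k : ℕ × ℕ × ℕ | k.1 ≤ t + 1}, MeasurableSpace.comap (Z k) inferInstance) le_rfl
    have h2 := measurable_round (Z := Z) {k | k.1 ≤ t + 1} (t + 1) fun i b => le_refl (t + 1)
    have hstep : Measurable fun p : Vec d × (ℕ → ℕ → Vec d × ℝ) =>
        H (p.1 - η • gradEst m (B (t + 1)) p.2 p.1) :=
      hH.comp (measurable_fst.sub ((measurable_gradEst m _).const_smul η))
    exact hstep.comp (h1.prodMk h2)

variable [MeasurableSpace Ω] {P : Measure Ω}

theorem indepFun_exploration_round (hZm : ∀ k, Measurable (Z k)) (hZ : iIndepFun Z P)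
    {H : Vec d → Vec d} (hH : Measurable H) (η : ℝ) (m : ℕ) (B : ℕ → ℕ) (θ₀ : Vec d) (t : ℕ) :
    IndepFun (fun ω => exploration H η m B (fun t i b => Z (t, i, b) ω) θ₀ t)
      (fun ω => (fun i b => Z (t + 1, i, b) ω : ℕ → ℕ → Vec d × ℝ)) P := by
  have h1 := indep_iSup_of_disjoint (fun k => (hZm k).comap_le) hZ.iIndep
    (S := {k : ℕ × ℕ × ℕ | k.1 ≤ t}) (T := {k | k.1 = t + 1}) (by
      rw [Set.disjoint_left]
      intro k hk hk'
      simp only [Set.mem_ofPred_eq] at hk hk'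
      omega)
  rw [IndepFun_iff_Indep]
  exact indep_of_indep_of_le_left (indep_of_indep_of_le_right h1
    (measurable_round _ _ fun i b => rfl).comap_le)
    (measurable_exploration hH η m B θ₀ t).comap_le

theorem measurable_exploration' (hZm : ∀ k, Measurable (Z k)) {H : Vec d → Vec d}
    (hH : Measurable H) (η : ℝ) (m : ℕ) (B : ℕ → ℕ) (θ₀ : Vec d) (t : ℕ) :
    Measurable fun ω => exploration H η m B (fun t i b => Z (t, i, b) ω) θ₀ t :=
  (measurable_exploration hH η m B θ₀ t).mono (iSup₂_le fun k _ => (hZm k).comap_le) le_rfl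

theorem measurable_round' (hZm : ∀ k, Measurable (Z k)) (t : ℕ) :
    Measurable fun ω => (fun i b => Z (t, i, b) ω : ℕ → ℕ → Vec d × ℝ) :=
  measurable_pi_lambda _ fun i => measurable_pi_lambda _ fun b => hZm (t, i, b)

end Measurability

end SparseReg

/-! ### Contractions with random errors -/

section Recursion

variable {Ω : Type*} [MeasurableSpace Ω] {P : Measure Ω} {E ζ : ℕ → Ω → ℝ} {α y γ e₀ : ℝ} {T p : ℕ}

theorem le_pow_mul_add_of_recursion {a : ℕ → ℝ} {b y : ℝ} (hb0 : 0 ≤ b) (hb1 : b ≤ 1)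
    (hy : 0 ≤ y) {T : ℕ} (h : ∀ t < T, a (t + 1) ≤ b * a t + y) : a T ≤ b ^ T * a 0 + T * y := by
  induction T with
  | zero => simp
  | succ T ih =>
    have h1 := ih fun t ht => h t (ht.trans T.lt_succ_self)
    calc a (T + 1) ≤ b * a T + y := h T T.lt_succ_self
      _ ≤ b * (b ^ T * a 0 + T * y) + y := by gcongr
      _ = b ^ (T + 1) * a 0 + b * (T * y) + y := by ring
      _ ≤ b ^ (T + 1) * a 0 + 1 * (T * y) + y := by gcongr
      _ = _ := by push_cast; ring

/-- A contraction with small errors in every round, by a union bound. -/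
theorem measure_not_contraction_le_of_tail (hα0 : 0 ≤ α) (hα : α ≤ 1 / 8) (hy : 0 ≤ y)
    (hE : ∀ t ω, 0 ≤ E t ω)
    (hrec : ∀ t < T, ∀ ω, E (t + 1) ω ≤ (1 - 8 * α) * E t ω + ζ t ω)
    (htail : ∀ t < T, P {ω | α * E t ω + y < ζ t ω} ≤ ENNReal.ofReal γ) (hE0 : ∀ ω, E 0 ω = e₀) :
    P {ω | ¬ E T ω ≤ (1 - α) ^ T * e₀ + T * y} ≤ ENNReal.ofReal (T * γ) := by
  have hsub : {ω | ¬ E T ω ≤ (1 - α) ^ T * e₀ + T * y} ⊆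
      ⋃ t ∈ Finset.range T, {ω | α * E t ω + y < ζ t ω} := by
    intro ω hω
    by_contra h
    simp only [Set.mem_iUnion, Finset.mem_range, Set.mem_ofPred_eq, not_exists, not_lt] at h
    refine hω ?_
    rw [← hE0 ω]
    refine le_pow_mul_add_of_recursion (a := fun t => E t ω) (by linarith) (by linarith) hy
      fun t ht => ?_
    -- If round `t` is good, its error costs one `α` of the rate and `y`; the rate `1 - 7α` is then
    -- relaxed to `1 - α`.
    have h1 := hrec t ht ω
    have h2 := h t ht
    have h3 := mul_nonneg hα0 (hE t ω)
    linarith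
  calc _ ≤ P (⋃ t ∈ Finset.range T, {ω | α * E t ω + y < ζ t ω}) := measure_mono hsub
    _ ≤ ∑ t ∈ Finset.range T, P {ω | α * E t ω + y < ζ t ω} := measure_biUnion_finset_le _ _
    _ ≤ ∑ t ∈ Finset.range T, ENNReal.ofReal γ :=
        Finset.sum_le_sum fun t ht => htail t (Finset.mem_range.mp ht)
    _ = _ := by
        rw [Finset.sum_const, Finset.card_range, nsmul_eq_mul, ENNReal.ofReal_mul (by positivity),
          ENNReal.ofReal_natCast]

variable [IsProbabilityMeasure P]

/-- The right side of the recursion is `1 - 7α` times a convex combination of `e` and `z / α`, so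
convexity of the power applies with no constant growing in `p`. -/
theorem contraction_pow_le (hα0 : 0 < α) (hα : α ≤ 1 / 16) {e e' z : ℝ} (he : 0 ≤ e)
    (he' : 0 ≤ e') (hz : 0 ≤ z) (h : e' ≤ (1 - 8 * α) * e + z) (p : ℕ) :
    e' ^ p ≤ (1 - 7 * α) ^ p * ((1 - α / (1 - 7 * α)) * e ^ p) +
      (1 - 7 * α) ^ p * (α / (1 - 7 * α) * (z / α) ^ p) := by
  have hq : 0 < 1 - 7 * α := by linarith
  have hw1 : 0 ≤ 1 - α / (1 - 7 * α) := by
    rw [sub_nonneg, div_le_one hq]; linarith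
  have hconv := (convexOn_pow p).2 (x := e) (y := z / α) he (div_nonneg hz hα0.le) hw1
    (div_nonneg hα0.le hq.le : 0 ≤ α / (1 - 7 * α)) (by ring)
  simp only [smul_eq_mul] at hconv
  calc e' ^ p ≤ ((1 - 8 * α) * e + z) ^ p := by gcongr
    _ = (1 - 7 * α) ^ p * ((1 - α / (1 - 7 * α)) * e + α / (1 - 7 * α) * (z / α)) ^ p := by
        rw [← mul_pow]
        congr 1
        have h8 : 1 - 8 * α = (1 - 7 * α) - α := by ring
        rw [h8]
        generalize 1 - 7 * α = q at hq
        field_simp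
    _ ≤ _ := by
        rw [← mul_add]
        gcongr

/-- Moments of a contraction whose errors have small conditional moments. -/
theorem lintegral_pow_le_of_contraction (hα0 : 0 < α) (hα : α ≤ 1 / 16) (hy : 0 ≤ y)
    (hγ0 : 0 ≤ γ) (hp : 1 ≤ p) (hγ : γ * 2 ^ p ≤ 1) (hEm : ∀ t, Measurable (E t))
    (hE : ∀ t ω, 0 ≤ E t ω) (hζ : ∀ t ω, 0 ≤ ζ t ω)
    (hrec : ∀ t < T, ∀ ω, E (t + 1) ω ≤ (1 - 8 * α) * E t ω + ζ t ω)
    (hmom : ∀ t < T, ∫⁻ ω, ENNReal.ofReal (ζ t ω ^ p) ∂P ≤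
      ∫⁻ ω, ENNReal.ofReal (γ * (α * E t ω + y) ^ p) ∂P) (hE0 : ∀ ω, E 0 ω = e₀) (he₀ : 0 ≤ e₀) :
    ∫⁻ ω, ENNReal.ofReal (E T ω ^ p) ∂P ≤
      ENNReal.ofReal ((1 - 7 * α) ^ (p * T) * e₀ ^ p + (y / α) ^ p) := by
  have hq : 0 < 1 - 7 * α := by linarith
  set w : ℝ := α / (1 - 7 * α) with hw
  have hw0 : 0 ≤ w := by positivity
  have hw1 : 0 ≤ 1 - w := by
    rw [sub_nonneg, div_le_one hq]; linarith
  induction T with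
  | zero =>
    simp only [hE0, lintegral_const, measure_univ, mul_one]
    refine ENNReal.ofReal_le_ofReal ?_
    have : 0 ≤ (y / α) ^ p := by positivity
    simpa
  | succ T ih =>
    have ih' := ih (fun t ht => hrec t (ht.trans T.lt_succ_self))
      (fun t ht => hmom t (ht.trans T.lt_succ_self))
    set Y : ℝ := (y / α) ^ p with hY
    have hY0 : 0 ≤ Y := by positivity
    set b : ℝ := (1 - 7 * α) ^ (p * T) * e₀ ^ p + Y with hb
    have hb0 : 0 ≤ b := by positivity
    -- The factor `2^(p-1)` from splitting `(α * E + y)^p` is absorbed by `γ`, so `ζ / α` has a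
    -- `p`-th moment no worse than the bound for `E` plus `Y`.
    have hζp : ∫⁻ ω, ENNReal.ofReal ((ζ T ω / α) ^ p) ∂P ≤ ENNReal.ofReal (b + Y) := by
      have h1 : ∀ ω, γ * (α * E T ω + y) ^ p ≤ α ^ p * (E T ω ^ p + Y) := by
        intro ω
        have h2 := add_pow_le (mul_nonneg hα0.le (hE T ω)) hy p
        have h3 : (2 : ℝ) ^ (p - 1) ≤ 2 ^ p := pow_le_pow_right₀ one_le_two (Nat.sub_le _ _)
        have hs : 0 ≤ (α * E T ω) ^ p + y ^ p :=
          add_nonneg (pow_nonneg (mul_nonneg hα0.le (hE T ω)) _) (by positivity)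
        calc γ * (α * E T ω + y) ^ p ≤ γ * (2 ^ p * ((α * E T ω) ^ p + y ^ p)) := by
              refine mul_le_mul_of_nonneg_left (h2.trans ?_) hγ0
              gcongr
          _ = (γ * 2 ^ p) * ((α * E T ω) ^ p + y ^ p) := by ring
          _ ≤ 1 * ((α * E T ω) ^ p + y ^ p) := by gcongr
          _ = α ^ p * (E T ω ^ p + Y) := by
              rw [hY, div_pow, mul_pow]
              field_simp
      have h4 : ∫⁻ ω, ENNReal.ofReal (ζ T ω ^ p) ∂P ≤
          ENNReal.ofReal (α ^ p) * ENNReal.ofReal (b + Y) := by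
        calc _ ≤ ∫⁻ ω, ENNReal.ofReal (α ^ p * (E T ω ^ p + Y)) ∂P :=
              (hmom T T.lt_succ_self).trans
                (lintegral_mono fun ω => ENNReal.ofReal_le_ofReal (h1 ω))
          _ = ENNReal.ofReal (α ^ p) * ∫⁻ ω, ENNReal.ofReal (E T ω ^ p + Y) ∂P := by
              have := hEm T
              rw [← lintegral_const_mul _ (by fun_prop)]
              exact lintegral_congr fun ω => ENNReal.ofReal_mul (by positivity)
          _ = ENNReal.ofReal (α ^ p) *
                (∫⁻ ω, ENNReal.ofReal (E T ω ^ p) ∂P + ENNReal.ofReal Y) := by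
              congr 1
              have h5 : ∀ ω, ENNReal.ofReal (E T ω ^ p + Y) =
                  ENNReal.ofReal (E T ω ^ p) + ENNReal.ofReal Y := fun ω =>
                ENNReal.ofReal_add (pow_nonneg (hE T ω) p) hY0
              simp only [h5]
              rw [lintegral_add_right _ measurable_const]
              simp
          _ ≤ _ := by
              rw [ENNReal.ofReal_add hb0 hY0]
              gcongr
      have h6 : ∀ ω, ENNReal.ofReal ((ζ T ω / α) ^ p) =
          ENNReal.ofReal ((α ^ p)⁻¹) * ENNReal.ofReal (ζ T ω ^ p) := by
        intro ω
        rw [← ENNReal.ofReal_mul (by positivity), div_pow, div_eq_inv_mul]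
      simp only [h6]
      rw [lintegral_const_mul' _ _ ENNReal.ofReal_ne_top]
      refine (mul_le_mul_right h4 _).trans ?_
      rw [← mul_assoc, ← ENNReal.ofReal_mul (by positivity), inv_mul_cancel₀ (by positivity),
        ENNReal.ofReal_one, one_mul]
    calc ∫⁻ ω, ENNReal.ofReal (E (T + 1) ω ^ p) ∂P
        ≤ ∫⁻ ω, (ENNReal.ofReal ((1 - 7 * α) ^ p * (1 - w)) * ENNReal.ofReal (E T ω ^ p) +
            ENNReal.ofReal ((1 - 7 * α) ^ p * w) * ENNReal.ofReal ((ζ T ω / α) ^ p)) ∂P := by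
          refine lintegral_mono fun ω => ?_
          rw [← ENNReal.ofReal_mul (by positivity), ← ENNReal.ofReal_mul (by positivity),
            ← ENNReal.ofReal_add
              (mul_nonneg (by positivity) (pow_nonneg (hE T ω) p))
              (mul_nonneg (by positivity) (pow_nonneg (div_nonneg (hζ T ω) hα0.le) p))]
          refine ENNReal.ofReal_le_ofReal ?_
          have := contraction_pow_le hα0 hα (hE T ω) (hE (T + 1) ω) (hζ T ω)
            (hrec T T.lt_succ_self ω) p
          rw [mul_assoc, mul_assoc]
          exact this
      _ = ENNReal.ofReal ((1 - 7 * α) ^ p * (1 - w)) * ∫⁻ ω, ENNReal.ofReal (E T ω ^ p) ∂P +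
            ENNReal.ofReal ((1 - 7 * α) ^ p * w) * ∫⁻ ω, ENNReal.ofReal ((ζ T ω / α) ^ p) ∂P := by
          have := hEm T
          rw [lintegral_add_left (by fun_prop), lintegral_const_mul' _ _ ENNReal.ofReal_ne_top,
            lintegral_const_mul' _ _ ENNReal.ofReal_ne_top]
      _ ≤ ENNReal.ofReal ((1 - 7 * α) ^ p * (1 - w)) * ENNReal.ofReal b +
            ENNReal.ofReal ((1 - 7 * α) ^ p * w) * ENNReal.ofReal (b + Y) := by gcongr
      _ = ENNReal.ofReal ((1 - 7 * α) ^ p * (b + w * Y)) := by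
          rw [← ENNReal.ofReal_mul (by positivity), ← ENNReal.ofReal_mul (by positivity),
            ← ENNReal.ofReal_add (by positivity) (by positivity)]
          ring_nf
      _ ≤ _ := by
          refine ENNReal.ofReal_le_ofReal ?_
          have h1 : (1 - 7 * α) ^ p ≤ 1 - 7 * α := by
            calc (1 - 7 * α) ^ p ≤ (1 - 7 * α) ^ 1 :=
                  pow_le_pow_of_le_one hq.le (by linarith) hp
              _ = _ := pow_one _
          -- The additive term reproduces itself since `(1 - 7α)(1 + w) = 1 - 6α`, so the bound does
          -- not accumulate over rounds.
          have h2 : (1 - 7 * α) * ((1 + w) * Y) ≤ Y := by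
            have : (1 - 7 * α) * ((1 + w) * Y) = (1 - 6 * α) * Y := by
              rw [hw]; field_simp; ring
            rw [this]
            nlinarith
          calc (1 - 7 * α) ^ p * (b + w * Y)
              = (1 - 7 * α) ^ (p * (T + 1)) * e₀ ^ p + (1 - 7 * α) ^ p * ((1 + w) * Y) := by
                rw [hb, mul_add p, mul_one, pow_add]; ring
            _ ≤ (1 - 7 * α) ^ (p * (T + 1)) * e₀ ^ p + (1 - 7 * α) * ((1 + w) * Y) := by
                gcongr
            _ ≤ _ := by linarith

/-- A contraction with small conditional error moments that runs for a long time. -/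
theorem measure_not_contraction_le_of_moment {Δ δ : ℝ} (hα0 : 0 < α) (hα : α ≤ 1 / 16)
    (hγ0 : 0 ≤ γ) (hp : 1 ≤ p) (hγ : γ * 2 ^ p ≤ 1) (hEm : ∀ t, Measurable (E t))
    (hE : ∀ t ω, 0 ≤ E t ω) (hζ : ∀ t ω, 0 ≤ ζ t ω)
    (hrec : ∀ t < T, ∀ ω, E (t + 1) ω ≤ (1 - 8 * α) * E t ω + ζ t ω)
    (hmom : ∀ t < T, ∫⁻ ω, ENNReal.ofReal (ζ t ω ^ p) ∂P ≤
      ∫⁻ ω, ENNReal.ofReal (γ * (α * E t ω + y) ^ p) ∂P) (hE0 : ∀ ω, E 0 ω = e₀) (he₀ : 0 ≤ e₀)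
    (hΔ : 0 < Δ) (hT : 1 ≤ α * T) (hy : y = Δ * (1 - α) ^ T / (3 * T))
    (hδ : Real.exp (-p) ≤ δ / 2) :
    P {ω | ¬ E T ω ≤ (1 - α) ^ T * (e₀ + Δ)} ≤ ENNReal.ofReal δ := by
  have hq : 0 < 1 - 7 * α := by linarith
  have hα1 : 0 < 1 - α := by linarith
  have hTpos : (0 : ℝ) < T := by
    by_contra h
    have : α * T ≤ 0 := mul_nonpos_of_nonneg_of_nonpos hα0.le (not_lt.mp h)
    linarith
  have hy0 : 0 ≤ y := by rw [hy]; positivity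
  have hmain := lintegral_pow_le_of_contraction hα0 hα hy0 hγ0 hp hγ hEm hE hζ hrec hmom hE0 he₀
  set τ : ℝ := (1 - α) ^ T * (e₀ + Δ) with hτ
  have hτ0 : 0 < τ := by positivity
  have hnum : (1 - 7 * α) ^ (p * T) * e₀ ^ p + (y / α) ^ p ≤ δ * τ ^ p := by
    have h1 : (1 - 7 * α) ^ T ≤ Real.exp (-1) * (1 - α) ^ T := by
      -- The right side is at least `(1 - α)² ≥ 1 - 2α`.
      have h2 : 1 - 7 * α ≤ Real.exp (-α) * (1 - α) := by
        have := Real.add_one_le_exp (-α)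
        nlinarith
      calc (1 - 7 * α) ^ T ≤ (Real.exp (-α) * (1 - α)) ^ T := by gcongr
        _ = Real.exp (-(α * T)) * (1 - α) ^ T := by
            rw [mul_pow, ← Real.exp_nat_mul]; ring_nf
        _ ≤ _ := by gcongr
    have h3 : y / α ≤ Real.exp (-1) * ((1 - α) ^ T * Δ) := by
      -- The `3` in the definition of `y` is there because `e < 3`.
      have h4 : (1 / 3 : ℝ) ≤ Real.exp (-1) := by
        rw [Real.exp_neg, ← one_div]
        exact one_div_le_one_div_of_le (Real.exp_pos _) (by linarith [Real.exp_one_lt_d9])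
      have h5 : y / α = 1 / 3 * ((1 - α) ^ T * Δ) * (1 / (α * T)) := by
        rw [hy]; field_simp
      have h6 : 1 / (α * T) ≤ 1 := by
        rw [div_le_one (by positivity)]; exact hT
      rw [h5]
      calc 1 / 3 * ((1 - α) ^ T * Δ) * (1 / (α * T)) ≤ 1 / 3 * ((1 - α) ^ T * Δ) * 1 := by gcongr
        _ ≤ _ := by rw [mul_one]; gcongr
    have h7 : (1 - 7 * α) ^ T * e₀ ≤ Real.exp (-1) * τ := by
      calc (1 - 7 * α) ^ T * e₀ ≤ Real.exp (-1) * (1 - α) ^ T * e₀ := by gcongr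
        _ = Real.exp (-1) * ((1 - α) ^ T * e₀) := by ring
        _ ≤ _ := by rw [hτ]; gcongr; linarith
    have h8 : y / α ≤ Real.exp (-1) * τ := by
      refine h3.trans ?_
      rw [hτ]; gcongr; linarith
    have h9 : Real.exp (-1) ^ p = Real.exp (-p) := by
      rw [← Real.exp_nat_mul]; ring_nf
    calc (1 - 7 * α) ^ (p * T) * e₀ ^ p + (y / α) ^ p
        = ((1 - 7 * α) ^ T * e₀) ^ p + (y / α) ^ p := by
          rw [mul_pow, ← pow_mul, mul_comm T p]
      _ ≤ (Real.exp (-1) * τ) ^ p + (Real.exp (-1) * τ) ^ p := by gcongr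
      _ = 2 * Real.exp (-p) * τ ^ p := by rw [mul_pow, h9]; ring
      _ ≤ δ * τ ^ p := by gcongr; linarith
  have hsub : {ω | ¬ E T ω ≤ τ} ⊆
      {ω | ENNReal.ofReal (τ ^ p) ≤ ENNReal.ofReal (E T ω ^ p)} := by
    intro ω hω
    refine ENNReal.ofReal_le_ofReal ?_
    have : τ ≤ E T ω := (not_le.mp hω).le
    gcongr
  have hEmT := hEm T
  have hmarkov := mul_meas_ge_le_lintegral (μ := P)
    (f := fun ω => ENNReal.ofReal (E T ω ^ p)) (by fun_prop) (ENNReal.ofReal (τ ^ p))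
  have hτp : ENNReal.ofReal (τ ^ p) ≠ 0 := by
    rw [Ne, ENNReal.ofReal_eq_zero, not_le]; positivity
  have hfin : ENNReal.ofReal (τ ^ p) * P {ω | ¬ E T ω ≤ τ} ≤
      ENNReal.ofReal (τ ^ p) * ENNReal.ofReal δ := by
    rw [← ENNReal.ofReal_mul (by positivity), mul_comm (τ ^ p)]
    exact (mul_le_mul_right (measure_mono hsub) _).trans
      (hmarkov.trans (hmain.trans (ENNReal.ofReal_le_ofReal hnum)))
  exact (ENNReal.mul_le_mul_iff_right hτp ENNReal.ofReal_ne_top).mp hfin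

end Recursion

/-! ### Choice of constants and the failure probability -/

namespace SparseReg

/-- The part of the proxy driven by `e` carries the constant `192 = 2·6·4·4`, and `α` carries
`1/128`, whence `24576 = 192·128`. The noise part needs only `144 = 48·3`. -/
theorem variance_proxy_le {s L μ κ r σ α y Δ p B e ε : ℝ} {T : ℕ} (hL : 0 < L) (hμ : 0 < μ)
    (hκ : κ = L / μ) (hα : α = 1 / 128 / κ) (hα1 : 0 < 1 - α) (hΔ : 0 < Δ) (hT : 1 ≤ T)
    (hy : y = Δ * (1 - α) ^ T / (3 * T)) (hε : 0 < ε) (hB : 0 < B) (he : 0 ≤ e)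
    (h₁ : 24576 / ε * p * (κ ^ 2 * (r ^ 4 / L ^ 2) * s ^ 2) ≤ B)
    (h₂ : 24576 / ε * p * (σ ^ 2 / Δ * (r ^ 2 / L) * (T * s / (1 - α) ^ T)) ≤ B) :
    2 * s / L * (6 * p * ((4 * r ^ 4 * (4 * s * e / μ) + 4 * r ^ 2 * σ ^ 2) / B)) ≤
      ε * (α * e + y) := by
  have hT0 : (0 : ℝ) < T := by exact_mod_cast hT
  have hκ0 : 0 < κ := by rw [hκ]; positivity
  have hq : 0 < (1 - α) ^ T := by positivity
  have hy0 : 0 ≤ y := by rw [hy]; positivity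
  have h3 : 2 * s / L * (6 * p * (4 * r ^ 4 * (4 * s * e / μ) / B)) =
      (24576 / ε * p * (κ ^ 2 * (r ^ 4 / L ^ 2) * s ^ 2)) * (ε * (α * e) / B) := by
    rw [hα, hκ]; field_simp; ring
  have h4 : 2 * s / L * (6 * p * (4 * r ^ 2 * σ ^ 2 / B)) =
      (24576 / ε * p * (σ ^ 2 / Δ * (r ^ 2 / L) * (T * s / (1 - α) ^ T))) *
        (ε * (144 / 24576 * y) / B) := by
    rw [hy]
    generalize (1 - α) ^ T = q at hq
    field_simp; ring
  have hα0 : 0 ≤ α := by rw [hα]; positivity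
  have h5 := mul_le_mul_of_nonneg_right h₁ (by positivity : 0 ≤ ε * (α * e) / B)
  have h6 := mul_le_mul_of_nonneg_right h₂ (by positivity : 0 ≤ ε * (144 / 24576 * y) / B)
  rw [mul_div_cancel₀ _ hB.ne'] at h5 h6
  have h7 : 2 * s / L * (6 * p * ((4 * r ^ 4 * (4 * s * e / μ) + 4 * r ^ 2 * σ ^ 2) / B)) =
      2 * s / L * (6 * p * (4 * r ^ 4 * (4 * s * e / μ) / B)) +
        2 * s / L * (6 * p * (4 * r ^ 2 * σ ^ 2 / B)) := by ring
  rw [h7, h3, h4]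
  have h8 : ε * (144 / 24576 * y) ≤ ε * y := by
    gcongr
    linarith
  linarith

/-- The lower bounds on `Λ` and `M` absorb both roundings, through `p ≤ 3Λ` and `1 ≤ 8ΛM`. -/
theorem exists_batchSize {C Λ M : ℝ} {p : ℕ} (hC : 0 < C) (hΛ : 1 / 2 ≤ Λ) (hM : 1 / 4 ≤ M)
    (hp1 : 1 ≤ p) (hp : (p : ℝ) ≤ Λ + 1) :
    ∃ B₀ : ℕ, 1 ≤ B₀ ∧ (B₀ : ℝ) ≤ (3 * C + 8) * Λ * M ∧ C * p * M ≤ B₀ := by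
  have hp0 : (0 : ℝ) < p := by exact_mod_cast hp1
  have hpos : 0 < C * p * M := mul_pos (mul_pos hC hp0) (by linarith)
  refine ⟨⌈C * p * M⌉₊, Nat.ceil_pos.mpr hpos, ?_, Nat.le_ceil _⟩
  have h1 : C * p * M ≤ C * (3 * Λ) * M := by gcongr; linarith
  have h2 : 1 ≤ 8 * Λ * M := by nlinarith
  calc (⌈C * p * M⌉₊ : ℝ) ≤ C * p * M + 1 := (Nat.ceil_lt_add_one hpos.le).le
    _ ≤ C * (3 * Λ) * M + 8 * Λ * M := add_le_add h1 h2
    _ = _ := by ring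

/-- The moment order and failure level attached to `κ`, `d` and `δ`. -/
theorem failure_level_bounds {κ δ : ℝ} {d p : ℕ} (hκ : 1 ≤ κ) (hd : 2 ≤ d) (hδ0 : 0 < δ)
    (hδ1 : δ < 1) (hp1 : 1 ≤ p) (hp : Real.log (κ * d / δ) ≤ p) :
    Real.exp (-p) ≤ δ / 2 ∧ 2 * d * Real.exp (-9) ^ p * (128 * κ) ≤ δ ∧
      2 * d * Real.exp (-9) ^ p * 2 ^ p ≤ 1 := by
  have hd' : (2 : ℝ) ≤ d := by exact_mod_cast hd
  have hκd : 0 < κ * d := by positivity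
  have h1 : Real.exp (-p) ≤ δ / (κ * d) := by
    calc Real.exp (-p) ≤ Real.exp (-Real.log (κ * d / δ)) := by gcongr
      _ = δ / (κ * d) := by
        rw [Real.exp_neg, Real.exp_log (by positivity), inv_div]
  have h8 : 2 * Real.exp (-8) ≤ 1 / 128 := by
    have h2 : (2 : ℝ) ^ 8 ≤ Real.exp 8 := by
      have : Real.exp 8 = Real.exp 1 ^ 8 := by rw [← Real.exp_nat_mul]; norm_num
      rw [this]
      gcongr
      linarith [Real.add_one_le_exp (1 : ℝ)]
    rw [Real.exp_neg, ← div_eq_mul_inv, div_le_iff₀ (Real.exp_pos _)]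
    linarith
  -- One factor `e^{-p}` pays for `κd/δ`; the remaining `e^{-8p}` pays for the numerical constants
  -- and for `2^p`.
  have h9 : Real.exp (-9) ^ p = Real.exp (-p) * Real.exp (-8) ^ p := by
    rw [← Real.exp_nat_mul, ← Real.exp_nat_mul, ← Real.exp_add]; ring_nf
  have h10 : (2 * Real.exp (-8)) ^ p ≤ 1 / 128 :=
    (pow_le_of_le_one (by positivity) (by linarith) (by omega)).trans h8
  have h11 : Real.exp (-8) ^ p ≤ 1 / 256 :=
    (pow_le_of_le_one (by positivity) (by linarith) (by omega)).trans (by linarith)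
  refine ⟨h1.trans ?_, ?_, ?_⟩
  · gcongr
    nlinarith
  · calc 2 * d * Real.exp (-9) ^ p * (128 * κ)
        = 256 * (κ * d) * (Real.exp (-p) * Real.exp (-8) ^ p) := by rw [h9]; ring
      _ ≤ 256 * (κ * d) * (δ / (κ * d) * (1 / 256)) := by gcongr
      _ = δ := by field_simp
  · calc 2 * d * Real.exp (-9) ^ p * 2 ^ p
        = 2 * d * (Real.exp (-p) * (2 * Real.exp (-8)) ^ p) := by rw [h9, mul_pow]; ring
      _ ≤ 2 * d * (δ / (κ * d) * (1 / 128)) := by gcongr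
      _ = δ / κ * (1 / 64) := by field_simp; norm_num
      _ ≤ 1 * (1 / 64) := by
          gcongr
          rw [div_le_one (by linarith)]
          linarith
      _ ≤ 1 := by norm_num

variable {d : ℕ} {DX : Measure (Vec d)} {ν : Measure ℝ} {θstar : Vec d} {c r : ℝ≥0}

/-- The scaled squared supremum norm of the error of the gradient estimator. -/
noncomputable def gradErr (DX : Measure (Vec d)) (θstar : Vec d) (a : ℝ) (m B : ℕ) (θ : Vec d)
    (z : ℕ → ℕ → Vec d × ℝ) : ℝ :=
  a * ‖WithLp.ofLp (gradEst m B z θ - gradQuad DX (θ - θstar))‖ ^ 2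

theorem gradErr_nonneg {a : ℝ} (ha : 0 ≤ a) (m B : ℕ) (θ : Vec d) (z : ℕ → ℕ → Vec d × ℝ) :
    0 ≤ gradErr DX θstar a m B θ z :=
  mul_nonneg ha (sq_nonneg _)

variable [IsProbabilityMeasure DX] [IsProbabilityMeasure ν]

theorem measurable_gradErr (hR : ∀ᵐ x ∂DX, ∀ j, |x j| ≤ (r : ℝ)) (a : ℝ) (m B : ℕ) :
    Measurable fun p : Vec d × (ℕ → ℕ → Vec d × ℝ) => gradErr DX θstar a m B p.1 p.2 := by
  have h1 := measurable_gradEst (d := d) m B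
  have h2 := (continuous_gradQuad hR).measurable
  have h3 : Measurable fun p : Vec d × (ℕ → ℕ → Vec d × ℝ) =>
      gradEst m B p.2 p.1 - gradQuad DX (p.1 - θstar) :=
    h1.sub (h2.comp (measurable_fst.sub_const θstar))
  have h4 : Measurable fun v : Vec d => ‖WithLp.ofLp v‖ :=
    (continuous_norm.comp (PiLp.continuous_ofLp 2 _)).measurable
  exact ((h4.comp h3).pow_const 2).const_mul a

theorem gradErr_step {s : ℕ} {H : Vec d → Vec d} (hH : IsHardThreshold s H)
    (hR : ∀ᵐ x ∂DX, ∀ j, |x j| ≤ (r : ℝ)) {L μ : ℝ} (hL0 : 0 < L) (hμ0 : 0 < μ) (hLμ : μ ≤ L)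
    (hs : 1 ≤ s) (hx : 64 * (L / μ) ^ 2 * l0 θstar ≤ s) (hx' : l0 θstar ≤ s)
    (hL : ∀ θ₁ θ₂ : Vec d, l0 θ₁ ≤ s → l0 θ₂ ≤ s → quad DX (θ₁ - θ₂) ≤ L / 2 * ‖θ₁ - θ₂‖ ^ 2)
    (hμ : ∀ θ₁ θ₂ : Vec d, l0 θ₁ ≤ s → l0 θ₂ ≤ s → μ / 2 * ‖θ₁ - θ₂‖ ^ 2 ≤ quad DX (θ₁ - θ₂))
    (m B : ℕ) (z : ℕ → ℕ → Vec d × ℝ) {θ : Vec d} (hθ : l0 θ ≤ s) :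
    quad DX (H (θ - (1 / 2 / L) • gradEst m B z θ) - θstar) ≤
      (1 - 1 / (16 * (L / μ))) * quad DX (θ - θstar) +
        gradErr DX θstar (2 * s / L) m B θ z := by
  refine hardThreshold_step_le hH hL0 hμ0 hLμ θ θstar (gradEst m B z θ)
    (gradQuad DX (θ - θstar)) hs hθ hx (inner_gradQuad_self hR _) (hμ _ _ hθ hx') ?_
    (sq_nonneg _) fun j => ?_
  · set u := H (θ - (1 / 2 / L) • gradEst m B z θ)
    have h1 : u - θstar = (θ - θstar) + (u - θ) := by abel
    rw [h1, quad_add hR]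
    have := hL u θ (hH _).1 hθ
    linarith
  · have h1 := norm_le_pi_norm (WithLp.ofLp (gradEst m B z θ - gradQuad DX (θ - θstar))) j
    rw [Real.norm_eq_abs] at h1
    rw [← sq_abs (gradEst m B z θ j - gradQuad DX (θ - θstar) j)]
    exact pow_le_pow_left₀ (abs_nonneg _) h1 2

variable {Ω : Type*} [MeasurableSpace Ω] {P : Measure Ω} [IsProbabilityMeasure P]
  {Z : ℕ × ℕ × ℕ → Ω → Vec d × ℝ}

/-- Here `θ` is frozen; decoupling later inserts the random iterate. As `θ - θstar` has at most `2s`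
nonzero entries, Cauchy–Schwarz and strong convexity give `‖θ - θ_*‖₁² ≤ 2s · 2e/μ`. -/
theorem lintegral_gradErr_pow_le (hZm : ∀ k, Measurable (Z k)) (hZ : iIndepFun Z P)
    (hlaw : ∀ k, HasLaw (Z k) (jointLaw DX ν θstar) P) (hR : ∀ᵐ x ∂DX, ∀ j, |x j| ≤ (r : ℝ))
    (hc : HasSubgaussianMGF (fun ξ : ℝ => ξ) c ν) {s : ℕ} {μ : ℝ} (hμ0 : 0 < μ)
    (hx' : l0 θstar ≤ s)
    (hμ : ∀ θ₁ θ₂ : Vec d, l0 θ₁ ≤ s → l0 θ₂ ≤ s → μ / 2 * ‖θ₁ - θ₂‖ ^ 2 ≤ quad DX (θ₁ - θ₂))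
    (m t : ℕ) {B p : ℕ} (hB : 1 ≤ B) (hp : 1 ≤ p) {θ : Vec d} (hθ : l0 θ ≤ s) {a b ε : ℝ}
    (ha : 0 ≤ a)
    (hb : a * (6 * p * ((4 * r ^ 4 * (4 * s * quad DX (θ - θstar) / μ) + 4 * r ^ 2 * c) / B)) ≤
      ε * b) :
    ∫⁻ ω, ENNReal.ofReal (gradErr DX θstar a m B θ (fun i b => Z (t, i, b) ω) ^ p) ∂P ≤
      ENNReal.ofReal (2 * d * ε ^ p * b ^ p) := by
  set e := quad DX (θ - θstar) with he
  have he0 : 0 ≤ e := quad_nonneg _ _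
  have hA : (∑ j, |(θ - θstar) j|) ^ 2 ≤ 4 * s * e / μ := by
    have h1 := sum_abs_sq_le_of_supp_subset (supp_sub_subset θ θstar)
    have h2 : ((supp θ ∪ supp θstar).card : ℝ) ≤ 2 * s := by
      have h3 : (supp θ ∪ supp θstar).card ≤ 2 * s := (Finset.card_union_le _ _).trans (by
        change l0 θ + l0 θstar ≤ 2 * s; omega)
      exact_mod_cast h3
    have h3 : ‖θ - θstar‖ ^ 2 ≤ 2 * e / μ := by
      rw [le_div_iff₀ hμ0]
      have := hμ θ θstar hθ hx'
      linarith
    calc _ ≤ _ := h1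
      _ ≤ 2 * s * (2 * e / μ) := by gcongr
      _ = _ := by ring
  have h1 := lintegral_gradEst_error_le hZm hZ hlaw hR hc θ m t hB hp hA
  set V : ℝ := 6 * p * ((4 * r ^ 4 * (4 * s * e / μ) + 4 * r ^ 2 * c) / B) with hV
  have hV0 : 0 ≤ V := by positivity
  clear_value V
  have h2 : ∀ ω, ENNReal.ofReal (gradErr DX θstar a m B θ (fun i b => Z (t, i, b) ω) ^ p) =
      ENNReal.ofReal (a ^ p) * ENNReal.ofReal (‖WithLp.ofLp (gradEst m B
        (fun i b => Z (t, i, b) ω) θ - gradQuad DX (θ - θstar))‖ ^ (2 * p)) := by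
    intro ω
    rw [← ENNReal.ofReal_mul (by positivity), gradErr, mul_pow, ← pow_mul]
  simp only [h2]
  rw [lintegral_const_mul' _ _ ENNReal.ofReal_ne_top]
  refine (mul_le_mul_right h1 _).trans ?_
  rw [← ENNReal.ofReal_mul (by positivity)]
  refine ENNReal.ofReal_le_ofReal ?_
  calc a ^ p * (2 * d * V ^ p) = 2 * d * (a * V) ^ p := by rw [mul_pow]; ring
    _ ≤ 2 * d * (ε * b) ^ p := by gcongr
    _ = _ := by rw [mul_pow]; ring

/-- The exploration algorithm run on measurable examples. -/
theorem measure_exploration_failure_le (hZm : ∀ k, Measurable (Z k)) (hZ : iIndepFun Z P)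
    (hlaw : ∀ k, HasLaw (Z k) (jointLaw DX ν θstar) P) (hR : ∀ᵐ x ∂DX, ∀ j, |x j| ≤ (r : ℝ))
    {σ : ℝ≥0} (hc : HasSubgaussianMGF (fun ξ : ℝ => ξ) (σ ^ 2) ν) {s : ℕ} {L μ κ α : ℝ}
    (hL0 : 0 < L) (hμ0 : 0 < μ) (hLμ : μ ≤ L) (hd : 2 ≤ d) (hs : 1 ≤ s)
    (hκ : κ = L / μ) (hα : α = 1 / 128 / κ)
    (hx : 64 * κ ^ 2 * l0 θstar ≤ s)
    (hL : ∀ θ₁ θ₂ : Vec d, l0 θ₁ ≤ s → l0 θ₂ ≤ s → quad DX (θ₁ - θ₂) ≤ L / 2 * ‖θ₁ - θ₂‖ ^ 2)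
    (hμ : ∀ θ₁ θ₂ : Vec d, l0 θ₁ ≤ s → l0 θ₂ ≤ s → μ / 2 * ‖θ₁ - θ₂‖ ^ 2 ≤ quad DX (θ₁ - θ₂))
    {H : Vec d → Vec d} (hHm : Measurable H) (hH : IsHardThreshold s H) (m : ℕ) {T p : ℕ}
    (θ₀ : Vec d) {δ Δ : ℝ} (hδ0 : 0 < δ) (hδ1 : δ < 1) (hΔ : 0 < Δ) (hp1 : 1 ≤ p)
    (hp : Real.log (κ * d / δ) ≤ p) (hT : 1 ≤ T) {B : ℕ → ℕ}
    (hB : ∀ t, 1 ≤ t → t ≤ T → 1 ≤ B t ∧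
      24576 / Real.exp (-9) * p * (κ ^ 2 * (r ^ 4 / L ^ 2) * s ^ 2) ≤ B t ∧
      24576 / Real.exp (-9) * p * (σ ^ 2 / Δ * (r ^ 2 / L) * (T * s / (1 - α) ^ T)) ≤ B t) :
    P {ω | ¬ quad DX (exploration H (1 / 2 / L) m B (fun t i b => Z (t, i, b) ω) θ₀ T - θstar) ≤
      (1 - α) ^ T * (quad DX (H θ₀ - θstar) + Δ)} ≤ ENNReal.ofReal δ := by
  have hκ1 : 1 ≤ κ := by rw [hκ, le_div_iff₀ hμ0]; linarith
  have hα0 : 0 < α := by rw [hα]; positivity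
  have hα16 : α ≤ 1 / 16 := by
    rw [hα, div_le_iff₀ (by linarith)]; linarith
  have hα1 : 0 < 1 - α := by linarith
  have hT0 : (0 : ℝ) < T := by exact_mod_cast hT
  have hx' : l0 θstar ≤ s := by
    have h1 : (0 : ℝ) ≤ l0 θstar := Nat.cast_nonneg _
    have h2 : 1 ≤ κ ^ 2 := one_le_pow₀ hκ1
    have h3 := mul_le_mul_of_nonneg_right h2 h1
    have : (l0 θstar : ℝ) ≤ s := by linarith
    exact_mod_cast this
  obtain ⟨hexp, hγκ, hγ2⟩ := failure_level_bounds hκ1 hd hδ0 hδ1 hp1 hp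
  set ε : ℝ := Real.exp (-9) with hε
  have hε0 : 0 < ε := Real.exp_pos _
  set γ : ℝ := 2 * d * ε ^ p with hγ
  have hγ0 : 0 ≤ γ := by positivity
  obtain ⟨y, hy⟩ : ∃ y, y = Δ * (1 - α) ^ T / (3 * T) := ⟨_, rfl⟩
  have hy0 : 0 < y := by rw [hy]; positivity
  set X : ℕ → Ω → Vec d :=
    fun t ω => exploration H (1 / 2 / L) m B (fun t i b => Z (t, i, b) ω) θ₀ t with hX
  set a : ℝ := 2 * s / L with ha
  have ha0 : 0 ≤ a := by positivity
  set Y : ℕ → Ω → ℕ → ℕ → Vec d × ℝ := fun t ω i b => Z (t + 1, i, b) ω with hY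
  have hXm : ∀ t, Measurable (X t) := fun t => measurable_exploration' hZm hHm _ m B θ₀ t
  have hYm : ∀ t, Measurable (Y t) := fun t => measurable_round' hZm (t + 1)
  have hXs : ∀ t ω, l0 (X t ω) ≤ s := fun t ω => l0_exploration_le hH _ m B _ θ₀ t
  have hind : ∀ t, IndepFun (X t) (Y t) P := fun t =>
    indepFun_exploration_round hZm hZ hHm _ m B θ₀ t
  set E : ℕ → Ω → ℝ := fun t ω => quad DX (X t ω - θstar) with hE
  set ζ : ℕ → Ω → ℝ := fun t ω => gradErr DX θstar a m (B (t + 1)) (X t ω) (Y t ω) with hζ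
  have hqm := (continuous_quad hR).measurable
  have hEm : ∀ t, Measurable (E t) := fun t => hqm.comp ((hXm t).sub_const θstar)
  have hE0 : ∀ t ω, 0 ≤ E t ω := fun t ω => quad_nonneg _ _
  have hζ0 : ∀ t ω, 0 ≤ ζ t ω := fun t ω => gradErr_nonneg ha0 _ _ _ _
  have hrec : ∀ t < T, ∀ ω, E (t + 1) ω ≤ (1 - 8 * α) * E t ω + ζ t ω := by
    intro t _ ω
    have h1 := gradErr_step hH hR hL0 hμ0 hLμ hs (by rw [← hκ]; exact hx) hx' hL hμ m (B (t + 1))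
      (Y t ω) (hXs t ω)
    have h2 : 1 - 8 * α = 1 - 1 / (16 * (L / μ)) := by
      rw [hα, ← hκ]; field_simp; ring
    rw [h2]
    exact h1
  have hcond : ∀ t < T, ∀ ω, ∫⁻ ω', ENNReal.ofReal
      (gradErr DX θstar a m (B (t + 1)) (X t ω) (Y t ω') ^ p) ∂P ≤
      ENNReal.ofReal (γ * (α * E t ω + y) ^ p) := by
    intro t ht ω
    obtain ⟨hB1, hB2, hB3⟩ := hB (t + 1) (by omega) (by omega)
    refine lintegral_gradErr_pow_le hZm hZ hlaw hR hc hμ0 hx' hμ m (t + 1) hB1 hp1 (hXs t ω) ha0 ?_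
    have hB0 : (0 : ℝ) < B (t + 1) := by exact_mod_cast hB1
    have := variance_proxy_le hL0 hμ0 hκ hα hα1 hΔ hT hy hε0 hB0 (hE0 t ω) hB2 hB3
    push_cast
    exact this
  have hmom : ∀ t < T, ∫⁻ ω, ENNReal.ofReal (ζ t ω ^ p) ∂P ≤
      ∫⁻ ω, ENNReal.ofReal (γ * (α * E t ω + y) ^ p) ∂P := by
    intro t ht
    have h1 := (hind t).lintegral_decouple (hXm t) (hYm t)
      (F := fun q => ENNReal.ofReal (gradErr DX θstar a m (B (t + 1)) q.1 q.2 ^ p))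
      ((measurable_gradErr hR a m _).pow_const p).ennreal_ofReal
    exact h1.le.trans (lintegral_mono fun ω => hcond t ht ω)
  have hstart : ∀ ω, E 0 ω = quad DX (H θ₀ - θstar) := fun ω => rfl
  rcases le_or_gt 1 (α * T) with hαT | hαT
  · exact measure_not_contraction_le_of_moment hα0 hα16 hγ0 hp1 hγ2 hEm hE0 hζ0 hrec hmom
      hstart (quad_nonneg _ _) hΔ hαT hy hexp
  · have hpos : ∀ t ω, 0 < α * E t ω + y := fun t ω =>
      add_pos_of_nonneg_of_pos (mul_nonneg hα0.le (hE0 t ω)) hy0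
    have htail : ∀ t < T, P {ω | α * E t ω + y < ζ t ω} ≤ ENNReal.ofReal γ := by
      intro t ht
      -- The threshold `α * E + y` is itself random. Dividing by its `p`-th power before integrating
      -- gives Markov's inequality conditionally on the past.
      set F : Vec d × (ℕ → ℕ → Vec d × ℝ) → ENNReal := fun q =>
        ENNReal.ofReal (((α * quad DX (q.1 - θstar) + y) ^ p)⁻¹) *
          ENNReal.ofReal (gradErr DX θstar a m (B (t + 1)) q.1 q.2 ^ p) with hF
      have hFm : Measurable F := by
        refine Measurable.mul ?_ ((measurable_gradErr hR a m _).pow_const p).ennreal_ofReal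
        have h1 : Measurable fun q : Vec d × (ℕ → ℕ → Vec d × ℝ) => quad DX (q.1 - θstar) :=
          hqm.comp (measurable_fst.sub_const θstar)
        fun_prop
      have h1 : ∫⁻ ω, F (X t ω, Y t ω) ∂P ≤ ENNReal.ofReal γ := by
        rw [(hind t).lintegral_decouple (hXm t) (hYm t) hFm]
        calc _ ≤ ∫⁻ ω, ENNReal.ofReal γ ∂P := by
              refine lintegral_mono fun ω => ?_
              simp only [hF]
              rw [lintegral_const_mul' _ _ ENNReal.ofReal_ne_top]
              refine (mul_le_mul_right (hcond t ht ω) _).trans ?_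
              have h2 := hpos t ω
              have h3 : 0 < (α * E t ω + y) ^ p := pow_pos h2 p
              rw [← ENNReal.ofReal_mul (inv_nonneg.mpr h3.le)]
              refine ENNReal.ofReal_le_ofReal (le_of_eq ?_)
              change ((α * E t ω + y) ^ p)⁻¹ * (γ * (α * E t ω + y) ^ p) = γ
              field_simp
          _ = _ := by simp
      have h2 := mul_meas_ge_le_lintegral (μ := P) (f := fun ω => F (X t ω, Y t ω))
        (hFm.comp ((hXm t).prodMk (hYm t))) 1
      rw [one_mul] at h2
      refine (measure_mono fun ω hω => ?_).trans (h2.trans h1)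
      have h3 := hpos t ω
      have h4 : α * E t ω + y ≤ ζ t ω := le_of_lt hω
      have h5 : 0 < (α * E t ω + y) ^ p := pow_pos h3 p
      change 1 ≤ ENNReal.ofReal (((α * E t ω + y) ^ p)⁻¹) * ENNReal.ofReal (ζ t ω ^ p)
      rw [← ENNReal.ofReal_mul (inv_nonneg.mpr h5.le), ENNReal.one_le_ofReal,
        ← div_eq_inv_mul, one_le_div h5]
      exact pow_le_pow_left₀ h3.le h4 p
    have h1 := measure_not_contraction_le_of_tail hα0.le (by linarith) hy0.le hE0 hrec htail hstart
    have hTκ : (T : ℝ) ≤ 128 * κ := by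
      have h2 : α * (128 * κ) = 1 := by rw [hα]; field_simp
      exact le_of_mul_le_mul_left (by linarith) hα0
    have hTγ : T * γ ≤ δ := by
      calc T * γ ≤ 128 * κ * γ := by gcongr
        _ ≤ δ := by linarith
    refine (measure_mono fun ω hω => ?_).trans (h1.trans (ENNReal.ofReal_le_ofReal hTγ))
    intro hle
    refine hω (hle.trans ?_)
    have h2 : T * y ≤ (1 - α) ^ T * Δ := by
      have h3 : T * y = 1 / 3 * ((1 - α) ^ T * Δ) := by rw [hy]; field_simp
      have h4 : 0 ≤ (1 - α) ^ T * Δ := by positivity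
      rw [h3]; linarith
    rw [mul_add]
    linarith

end SparseReg

/-! ### Assembly -/

theorem theorem1 :
    -- universal constants
    ∃ Cs cη cα CB : ℝ, 0 < Cs ∧ 0 < cη ∧ 0 < cα ∧ cα < 1 ∧ 0 < CB ∧
    ∀ (d : ℕ)
      -- the sparse linear model
      (DX : Measure (SparseReg.Vec d)) [IsProbabilityMeasure DX]
      (ν : Measure ℝ) [IsProbabilityMeasure ν]
      (θstar : SparseReg.Vec d) (σ : ℝ≥0) (R : ℝ)
      (_ : ∫ ξ, ξ ∂ν = 0) (_ : HasSubgaussianMGF (fun ξ : ℝ => ξ) (σ ^ 2) ν)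
      -- bounded data
      (_ : ∀ᵐ x ∂DX, ∀ j, |x j| ≤ R)
      -- sparsity level and number of observed attributes, `s, s' ∈ [d]`, `s < s'`
      (s s' : ℕ) (_ : 1 ≤ s) (_ : s < s') (_ : s' ≤ d)
      -- restricted smoothness and restricted strong convexity
      (Ls μs : ℝ) (_ : 0 < Ls) (_ : 0 < μs)
      (_ : SparseReg.RestrictedSmooth
        (SparseReg.risk (SparseReg.jointLaw DX ν θstar)) s Ls)
      (_ : SparseReg.RestrictedStronglyConvex
        (SparseReg.risk (SparseReg.jointLaw DX ν θstar)) s μs)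
      -- choice of the parameters
      (κ η α : ℝ) (_ : κ = Ls / μs) (_ : η = cη / Ls) (_ : α = cα / κ)
      (_ : Cs * κ ^ 2 * (SparseReg.l0 θstar : ℝ) ≤ (s : ℝ))
      -- hard thresholding operator
      (H : SparseReg.Vec d → SparseReg.Vec d) (_ : Measurable H)
      (_ : SparseReg.IsHardThreshold s H)
      (T : ℕ) (θ₀ : SparseReg.Vec d) (δ Δ : ℝ) (_ : 0 < δ) (_ : δ < 1) (_ : 0 < Δ),
    ∃ B₀ : ℕ, 1 ≤ B₀ ∧
      (B₀ : ℝ) ≤ CB * Real.log (κ * d / δ) *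
        max (κ ^ 2 * (R ^ 4 / Ls ^ 2) * (s : ℝ) ^ 2)
          ((σ : ℝ) ^ 2 / Δ * (R ^ 2 / Ls) * ((T : ℝ) * s / (1 - α) ^ T)) ∧
      ∀ B : ℕ → ℕ, (∀ t, 1 ≤ t → t ≤ T → B₀ ≤ B t) →
      -- i.i.d. examples, indexed by round, block and position in the mini-batch
      ∀ {Ω : Type*} [MeasurableSpace Ω] (P : Measure Ω) [IsProbabilityMeasure P]
        (Z : ℕ × ℕ × ℕ → Ω → SparseReg.Vec d × ℝ)
        (_ : iIndepFun Z P)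
        (_ : ∀ k, HasLaw (Z k) (SparseReg.jointLaw DX ν θstar) P),
      1 - δ ≤ P.real {ω |
        SparseReg.risk (SparseReg.jointLaw DX ν θstar)
            (SparseReg.exploration H η (s' - s) B (fun t i b => Z (t, i, b) ω) θ₀ T) -
          SparseReg.risk (SparseReg.jointLaw DX ν θstar) θstar ≤
        (1 - α) ^ T *
          (SparseReg.risk (SparseReg.jointLaw DX ν θstar) (H θ₀) -
            SparseReg.risk (SparseReg.jointLaw DX ν θstar) θstar + Δ)} := by
  refine ⟨64, 1 / 2, 1 / 128, 3 * (24576 / Real.exp (-9)) + 8, by norm_num, by norm_num,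
    by norm_num, by norm_num, by positivity, ?_⟩
  intro d DX _ ν _ θstar σ R hν hc hR s s' hs hss' hs'd L μ hL0 hμ0 hRS hRSC κ η α hκ hη hα hsp H hHm
    hH T θ₀ δ Δ hδ0 hδ1 hΔ
  -- From `1 ≤ s < s' ≤ d`. This keeps `κ d / δ ≥ 2`, so the logarithm stays away from zero.
  have hd : 2 ≤ d := by omega
  have hR0 : 0 ≤ R := by
    obtain ⟨x, hx⟩ := hR.exists
    exact (abs_nonneg _).trans (hx ⟨0, by omega⟩)
  lift R to ℝ≥0 using hR0 with r
  have hL := fun θ₁ θ₂ : SparseReg.Vec d =>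
    SparseReg.quad_le_of_restrictedSmooth hR hν hc hRS (θ₁ := θ₁) (θ₂ := θ₂)
  have hμ := fun θ₁ θ₂ : SparseReg.Vec d =>
    SparseReg.le_quad_of_restrictedStronglyConvex hR hν hc hRSC (θ₁ := θ₁) (θ₂ := θ₂)
  obtain ⟨hLμ, hμr⟩ := SparseReg.le_and_le_of_quad_bounds hR (by omega) hs hL hμ
  have hκ1 : 1 ≤ κ := by rw [hκ, le_div_iff₀ hμ0]; linarith
  have hd' : (2 : ℝ) ≤ d := by exact_mod_cast hd
  have hs' : (1 : ℝ) ≤ s := by exact_mod_cast hs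
  set M : ℝ := max (κ ^ 2 * ((r : ℝ) ^ 4 / L ^ 2) * (s : ℝ) ^ 2)
    ((σ : ℝ) ^ 2 / Δ * ((r : ℝ) ^ 2 / L) * ((T : ℝ) * s / (1 - α) ^ T)) with hM
  -- As `κ / L = 1 / μ`, the first entry of the maximum is `(r² s / μ)²`, and `μ ≤ 2r²`.
  have hM4 : 1 / 4 ≤ M := by
    refine le_trans ?_ (le_max_left _ _)
    have h1 : 1 / 2 ≤ (r : ℝ) ^ 2 / μ := by rw [le_div_iff₀ hμ0]; linarith
    have h2 : κ ^ 2 * ((r : ℝ) ^ 4 / L ^ 2) * (s : ℝ) ^ 2 = ((r : ℝ) ^ 2 / μ * s) ^ 2 := by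
      rw [hκ]; field_simp
    have h3 : 1 / 2 * 1 ≤ (r : ℝ) ^ 2 / μ * s := mul_le_mul h1 hs' zero_le_one (by positivity)
    rw [h2]
    nlinarith
  set Λ : ℝ := Real.log (κ * d / δ) with hΛ
  have hΛ2 : 1 / 2 ≤ Λ := by
    have h1 : 2 ≤ κ * d / δ := by
      rw [le_div_iff₀ hδ0]
      nlinarith
    have h2 : Real.log 2 ≤ Λ := Real.log_le_log two_pos h1
    linarith [Real.log_two_gt_d9]
  have hp1 : 1 ≤ ⌈Λ⌉₊ := Nat.ceil_pos.mpr (by linarith)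
  obtain ⟨B₀, hB₀1, hB₀, hB₀M⟩ := SparseReg.exists_batchSize
    (C := 24576 / Real.exp (-9)) (by positivity) hΛ2 hM4 hp1
    (Nat.ceil_lt_add_one (by linarith)).le
  refine ⟨B₀, hB₀1, hB₀, ?_⟩
  intro B hB Ω _ P _ Z hZ hlaw
  set S : Set Ω := {ω |
    SparseReg.risk (SparseReg.jointLaw DX ν θstar)
        (SparseReg.exploration H η (s' - s) B (fun t i b => Z (t, i, b) ω) θ₀ T) -
      SparseReg.risk (SparseReg.jointLaw DX ν θstar) θstar ≤
    (1 - α) ^ T *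
      (SparseReg.risk (SparseReg.jointLaw DX ν θstar) (H θ₀) -
        SparseReg.risk (SparseReg.jointLaw DX ν θstar) θstar + Δ)} with hS
  have hexcess : ∀ θ, SparseReg.risk (SparseReg.jointLaw DX ν θstar) θ -
      SparseReg.risk (SparseReg.jointLaw DX ν θstar) θstar = SparseReg.quad DX (θ - θstar) := by
    intro θ
    rw [SparseReg.risk_jointLaw hR hν hc, SparseReg.risk_jointLaw hR hν hc, sub_self]
    simp [SparseReg.quad]
  simp only [hexcess] at hS
  -- Subadditivity alone passes to the complement, so measurability of `S` is not needed.
  suffices h : P Sᶜ ≤ ENNReal.ofReal δ by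
    have h1 : P.real Sᶜ ≤ δ := ENNReal.toReal_le_of_le_ofReal hδ0.le h
    have h2 := measureReal_union_le (μ := P) S Sᶜ
    rw [Set.union_compl_self, probReal_univ] at h2
    linarith
  rcases Nat.eq_zero_or_pos T with rfl | hT
  · have h1 : S = Set.univ := by
      rw [hS]
      refine Set.eq_univ_of_forall fun ω => ?_
      simp only [Set.mem_ofPred_eq, SparseReg.exploration, pow_zero, one_mul]
      linarith
    rw [h1, Set.compl_univ, measure_empty]
    exact zero_le
  -- The examples are only almost everywhere measurable; countably many measurable modifications
  -- change neither laws nor independence, and alter the event by a null set.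
  choose Z' hZ'm hZ' using fun k => (hlaw k).aemeasurable
  have hp0 : 0 ≤ 24576 / Real.exp (-9) * (⌈Λ⌉₊ : ℝ) := by positivity
  have hmain := SparseReg.measure_exploration_failure_le hZ'm (hZ.congr hZ')
    (fun k => (hlaw k).congr (hZ' k).symm) hR hc hL0 hμ0 hLμ hd hs hκ hα hsp hL hμ hHm hH (s' - s)
    θ₀ hδ0 hδ1 hΔ hp1 (Nat.le_ceil _) hT (B := B) (fun t ht htT => by
      have h1 : (B₀ : ℝ) ≤ B t := by exact_mod_cast hB t ht htT
      refine ⟨hB₀1.trans (hB t ht htT), ?_, ?_⟩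
      · exact (mul_le_mul_of_nonneg_left (le_max_left _ _) hp0).trans (hB₀M.trans h1)
      · exact (mul_le_mul_of_nonneg_left (le_max_right _ _) hp0).trans (hB₀M.trans h1))
  refine le_trans (le_of_eq (measure_congr ?_)) hmain
  filter_upwards [ae_all_iff.mpr hZ'] with ω hω
  have h1 : (fun t i b => Z (t, i, b) ω) = fun t i b => Z' (t, i, b) ω := by
    ext1 t; ext1 i; ext1 b; exact hω _
  rw [hS, hη]
  change (¬ SparseReg.quad DX (SparseReg.exploration H (1 / 2 / L) (s' - s) B
      (fun t i b => Z (t, i, b) ω) θ₀ T - θstar) ≤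
    (1 - α) ^ T * (SparseReg.quad DX (H θ₀ - θstar) + Δ)) = _
  rw [h1]
  rfl
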